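/- **Definitions.** For integers $1\le t<k$, the Johnson group $S_k^{(t)}$ is the symmetric group $\mathrm{Sym}(k)$ in its induced action on the set $X_k^t$ of $t$-element subsets of $[k]=\{1,\dots,k\}$, a domain of size $\binom kt$. Let $G\le \mathrm{Sym}(\Omega)$ be a permutation group; it acts on the assignments $\Omega\to\{0,1\}$. A Boolean circuit $\psi$ (AND-, OR-, NOT-gates, one output gate) whose variables lie in $\Omega\,\dot\cup\,\Omega'$, where $\Omega'$ is a set of additional variables, is a *complete symmetry breaking circuit with additional variables* for $G$ if every orbit $O$ of $G$ on the assignments $\Omega\to\{0,1\}$ contains an assignment $\tau$ such that $\psi[\tau]$ is satisfiable (by some assignment to $\Omega'$), while $\psi[\tau']$ is unsatisfiable for all $\tau'\in O$ with $\tau'\ne\tau$. A *canonical form* is a function $f$ from finite graphs, with vertex sets $[n]$, $n\ge 0$, to such graphs with $f(\Gamma)\cong\Gamma$ and $\Gamma\cong\Delta\iff f(\Gamma)=f(\Delta)$ for all graphs $\Gamma,\Delta$. The problem $d$-$\mathrm{gcanon}_f$ asks whether a given graph $\Gamma$ satisfies $f(\Gamma)=\Gamma$; $\mathsf{GI}$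 asks whether two given graphs are isomorphic. Graphs are given by adjacency matrices. **Theorem.** Let $t\ge 2$ be a fixed integer. Suppose there is an algorithm that, given $k>t$, computes a complete symmetry breaking circuit with additional variables for the Johnson group $S_k^{(t)}$ in time polynomial in the domain size $\binom kt$. Then there is a canonical form $f$ such that $d$-$\mathrm{gcanon}_f\in\mathsf{NP}$; and hence $\mathsf{GI}\in\mathsf{coNP}$. -/

import Mathlib

namespace SymBreak

/-! ### Machine model

A multi-stack machine with a finite control, given as a structured program. It has stacks of bits
(a program mentions only finitely many of them); in one step it pushes a constant bit, pops a bit,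
or branches on the top of a stack. A multi-tape Turing machine is the same thing up to a constant
factor in time: each tape is a pair of stacks. -/

/-- The contents of the stacks; the head of a list is the top of the stack. -/
abbrev Store : Type := ℕ → List Bool

/-- Programs. `branch r a b c` runs `a`, `b` or `c` according to whether stack `r` is empty, has
top `false`, or has top `true` (it does not pop); `loop r a` repeats `a` while stack `r` is
nonempty. -/
inductive Prog : Type
  | skip : Prog
  | push (r : ℕ) (b : Bool) : Prog
  | pop (r : ℕ) : Prog
  | seq (a b : Prog) : Prog
  | branch (r : ℕ) (onEmpty onFalse onTrue : Prog) : Prog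
  | loop (r : ℕ) (body : Prog) : Prog

/-- `Exec c s n s'`: started in `s`, the program `c` halts after exactly `n` steps in `s'`.
Every push, pop, skip, branching test and loop test is one step. -/
inductive Exec : Prog → Store → ℕ → Store → Prop
  | skip (s : Store) : Exec .skip s 1 s
  | push (r : ℕ) (b : Bool) (s : Store) :
      Exec (.push r b) s 1 (Function.update s r (b :: s r))
  | pop (r : ℕ) (s : Store) :
      Exec (.pop r) s 1 (Function.update s r (s r).tail)
  | seq {a b : Prog} {s s₁ s₂ : Store} {m n : ℕ} :
      Exec a s m s₁ → Exec b s₁ n s₂ → Exec (.seq a b) s (m + n) s₂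
  | branchEmpty {r : ℕ} {a b c : Prog} {s s₁ : Store} {n : ℕ} :
      s r = [] → Exec a s n s₁ → Exec (.branch r a b c) s (n + 1) s₁
  | branchFalse {r : ℕ} {a b c : Prog} {s s₁ : Store} {n : ℕ} :
      (s r).head? = some false → Exec b s n s₁ → Exec (.branch r a b c) s (n + 1) s₁
  | branchTrue {r : ℕ} {a b c : Prog} {s s₁ : Store} {n : ℕ} :
      (s r).head? = some true → Exec c s n s₁ → Exec (.branch r a b c) s (n + 1) s₁
  | loopDone {r : ℕ} {a : Prog} {s : Store} :
      s r = [] → Exec (.loop r a) s 1 s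
  | loopStep {r : ℕ} {a : Prog} {s s₁ s₂ : Store} {m n : ℕ} :
      s r ≠ [] → Exec a s m s₁ → Exec (.loop r a) s₁ n s₂ →
        Exec (.loop r a) s (m + n + 1) s₂

/-- Initial store: the inputs on the first stacks, all other stacks empty. -/
def inputStore (xs : List (List Bool)) : Store := fun i => xs.getD i []

/-- On the inputs `xs`, the program `c` halts within `T` steps with `out` on stack `0`. -/
def OutputsWithin (c : Prog) (xs : List (List Bool)) (T : ℕ) (out : List Bool) : Prop :=
  ∃ n ≤ T, ∃ s, Exec c (inputStore xs) n s ∧ s 0 = out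

/-! ### NP and coNP -/

/-- The binary relation `R` on strings is decidable in polynomial time: some program halts on every
pair of inputs within a number of steps that is polynomial in the input length, with the output `1`
if the relation holds and `0` if not. -/
def PolyTimeDecidable (R : List Bool → List Bool → Prop) : Prop :=
  ∃ (c : Prog) (q : Polynomial ℕ), ∀ x y : List Bool,
    (R x y → OutputsWithin c [x, y] (q.eval (x.length + y.length)) [true]) ∧
    (¬ R x y → OutputsWithin c [x, y] (q.eval (x.length + y.length)) [false])

/-- Languages with polynomially long certificates that are verifiable in polynomial time. -/
def NP : Set (Set (List Bool)) :=
  {L | ∃ (R : List Bool → List Bool → Prop) (p : Polynomial ℕ), PolyTimeDecidable R ∧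
    ∀ x, x ∈ L ↔ ∃ y : List Bool, y.length ≤ p.eval x.length ∧ R x y}

/-- Complements of languages in `NP`. -/
def coNP : Set (Set (List Bool)) := {L | Lᶜ ∈ NP}

/-! ### Graphs, graph isomorphism and decision canonization -/

/-- `1ⁿ0`. -/
def encodeNat (n : ℕ) : List Bool := List.replicate n true ++ [false]

open Classical in
/-- A graph on `n` vertices is written as `1ⁿ0` followed by its adjacency matrix, row by row. -/
noncomputable def encodeGraph {n : ℕ} (Γ : SimpleGraph (Fin n)) : List Bool :=
  encodeNat n ++
    (List.ofFn fun i : Fin n => List.ofFn fun j : Fin n => decide (Γ.Adj i j)).flatten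

/-- The graph isomorphism problem. -/
def GI : Set (List Bool) :=
  {x | ∃ (n m : ℕ) (Γ : SimpleGraph (Fin n)) (Δ : SimpleGraph (Fin m)),
    Nonempty (Γ ≃g Δ) ∧ x = encodeGraph Γ ++ encodeGraph Δ}

/-- Canonical forms of graphs. As `f Γ ≅ Γ`, the graphs `Γ` and `f Γ` have the same number of
vertices, and so have any two graphs that are isomorphic or have the same canonical form. -/
structure IsCanonicalForm (f : ∀ n : ℕ, SimpleGraph (Fin n) → SimpleGraph (Fin n)) : Prop where
  iso_iff : ∀ (n : ℕ) (Γ Δ : SimpleGraph (Fin n)), Nonempty (Γ ≃g Δ) ↔ f n Γ = f n Δ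
  iso_self : ∀ (n : ℕ) (Γ : SimpleGraph (Fin n)), Nonempty (f n Γ ≃g Γ)

/-- The decision canonization problem for `f`: is the given graph its own canonical form? -/
def dGCanon (f : ∀ n : ℕ, SimpleGraph (Fin n) → SimpleGraph (Fin n)) : Set (List Bool) :=
  {x | ∃ (n : ℕ) (Γ : SimpleGraph (Fin n)), f n Γ = Γ ∧ x = encodeGraph Γ}

/-! ### Boolean circuits -/

/-- Gates; the arguments of a gate are given by their positions in the list of gates. -/
inductive Gate (V : Type) : Type
  | var (v : V) : Gate V
  | neg (i : ℕ) : Gate V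
  | conj (i j : ℕ) : Gate V
  | disj (i j : ℕ) : Gate V

/-- The positions that feed a gate. -/
def Gate.args {V : Type} : Gate V → List ℕ
  | .var _ => []
  | .neg i => [i]
  | .conj i j => [i, j]
  | .disj i j => [i, j]

/-- A Boolean circuit over the variables `V`: gates in topological order; the last one is the
output gate. -/
structure Circuit (V : Type) : Type where
  gates : List (Gate V)
  nonempty : gates ≠ []
  acyclic : ∀ (i : ℕ) (hi : i < gates.length), ∀ j ∈ gates[i].args, j < i

/-- The value of a gate, given the values of the gates before it. -/
def Gate.eval {V : Type} (θ : V → Bool) (vals : List Bool) : Gate V → Bool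
  | .var v => θ v
  | .neg i => !(vals.getD i false)
  | .conj i j => vals.getD i false && vals.getD j false
  | .disj i j => vals.getD i false || vals.getD j false

/-- The values of all gates of a list, in order. -/
def gateValues {V : Type} (θ : V → Bool) (gs : List (Gate V)) : List Bool :=
  gs.foldl (fun vals g => vals ++ [g.eval θ vals]) []

/-- The value of the output gate. -/
def Circuit.eval {V : Type} (ψ : Circuit V) (θ : V → Bool) : Bool :=
  (gateValues θ ψ.gates).getLastD false

/-! ### Symmetry breaking -/

/-- The orbit of a complete assignment under a permutation group on the variables. -/
def assignmentOrbit {Ω : Type} (G : Subgroup (Equiv.Perm Ω)) (τ : Ω → Bool) : Set (Ω → Bool) :=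
  {τ' | ∃ g ∈ G, ∀ ω, τ' (g ω) = τ ω}

/-- `ψ[τ]` is satisfiable, where `τ` assigns the variables in `Ω` and `A` is the set of additional
variables. -/
def Circuit.SatisfiableAt {Ω A : Type} (ψ : Circuit (Ω ⊕ A)) (τ : Ω → Bool) : Prop :=
  ∃ η : A → Bool, ψ.eval (Sum.elim τ η) = true

/-- `ψ` is a complete symmetry breaking circuit with additional variables for `G`. -/
def IsCompleteSymmetryBreaking {Ω A : Type} (G : Subgroup (Equiv.Perm Ω))
    (ψ : Circuit (Ω ⊕ A)) : Prop :=
  ∀ τ : Ω → Bool, ∃ τ' ∈ assignmentOrbit G τ, ψ.SatisfiableAt τ' ∧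
    ∀ τ'' ∈ assignmentOrbit G τ, τ'' ≠ τ' → ¬ ψ.SatisfiableAt τ''

/-- The Johnson group: the symmetric group on `k` points in its action on the `t`-subsets. -/
def johnsonGroup (k t : ℕ) : Subgroup (Equiv.Perm (Set.powersetCard (Fin k) t)) :=
  (MulAction.toPermHom (Equiv.Perm (Fin k)) (Set.powersetCard (Fin k) t)).range

/-- A variable is either a `t`-subset of the `k` points, written as its characteristic vector, or
an additional variable, written as its number in unary. -/
def encodeVar {k t : ℕ} : Set.powersetCard (Fin k) t ⊕ ℕ → List Bool
  | .inl S => false :: List.ofFn fun i : Fin k => decide (i ∈ (S : Finset (Fin k)))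
  | .inr j => true :: encodeNat j

/-- A two-bit tag for the kind of the gate, then its variable or its arguments. -/
def encodeGate {k t : ℕ} : Gate (Set.powersetCard (Fin k) t ⊕ ℕ) → List Bool
  | .var v => [false, false] ++ encodeVar v
  | .neg i => [false, true] ++ encodeNat i
  | .conj i j => [true, false] ++ encodeNat i ++ encodeNat j
  | .disj i j => [true, true] ++ encodeNat i ++ encodeNat j

/-- The codes of the gates, one after the other. -/
def encodeCircuit {k t : ℕ} (ψ : Circuit (Set.powersetCard (Fin k) t ⊕ ℕ)) : List Bool :=
  ψ.gates.flatMap encodeGate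

/-- There is an algorithm that, given `k > t` (in unary), generates a complete symmetry breaking
circuit with additional variables for the Johnson group of `t`-subsets of `k` points, in time
polynomial in the size of the domain of this group. -/
def JohnsonSymmetryBreakingInPolyTime (t : ℕ) : Prop :=
  ∃ (c : Prog) (p : Polynomial ℕ), ∀ k : ℕ, t < k →
    ∃ ψ : Circuit (Set.powersetCard (Fin k) t ⊕ ℕ),
      IsCompleteSymmetryBreaking (johnsonGroup k t) ψ ∧
      OutputsWithin c [List.replicate k true] (p.eval (k.choose t)) (encodeCircuit ψ)

end SymBreak

/-! Graphs are turned into assignments for the Johnson group. Embed the `n` vertices of `Γ`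
injectively into `k` points by `e`; `hypergraph t Γ e` consists of the `t`-sets whose trace on the
vertices is an edge. Isomorphic graphs yield hypergraphs in one orbit (`hypergraph_mem_orbit`).
Conversely, sorting the embedding shows that every member of the orbit is the hypergraph of an
isomorphic graph under an increasing embedding (`exists_of_mem_orbit`). A complete symmetry breaking
circuit singles out one member, and this member determines the graph
(`eq_of_hypergraph_eq_of_strictMono`). For `t = 2` one takes `k = n`, and increasing embeddings are
onto. For `t ≥ 3` one takes `k > 2 * n` and `k ≥ n + t`. If there is an edge, swapping two points
outside the image does not change the hypergraph, while some set witnesses a change when an outside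
point is swapped with an image point (`exists_hypergraph_swap_ne`). Hence the image, the increasing
embedding and finally the graph are recovered. The selected graph is the canonical form
(`existsUnique_satisfiableAt`).

A certificate for `f n Γ = Γ` consists of an increasing embedding and of values of the additional
variables that satisfy the circuit; only variables whose number is below the length of the circuit's
code matter (`satisfiableAt_iff`). As `t` is fixed, `k` is linear in `n` and `k.choose t ≤ k ^ t`,
so the verifier can generate the circuit itself. Graphs with at most two vertices are separate:
there `k > t` may fail, but isomorphic graphs are equal.

Nonisomorphism of `Γ` and `Δ` is certified by permutations that turn them into their canonical forms
and by certificates that these forms are canonical; the verifier also checks that the two forms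
differ.

What remains is running time. `PolyTime` functions between coded types are closed under composition,
pairing, case distinction and iteration with bounded intermediate sizes, so `fun_prop` can assemble
the verifiers. `of_program` and `polyTimeDecidable_of_polyTime` connect them with the machine model.
-/

namespace SymBreak

open Function

/-! ### Running programs -/

/-- `c` halts on `s` in `s'` within `T` steps. -/
def Runs (c : Prog) (s : Store) (T : ℕ) (s' : Store) : Prop := ∃ n ≤ T, Exec c s n s'

theorem Runs.mono {c : Prog} {s s' : Store} {T T' : ℕ} (h : Runs c s T s') (hT : T ≤ T') :
    Runs c s T' s' :=
  let ⟨n, hn, he⟩ := h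
  ⟨n, hn.trans hT, he⟩

theorem Runs.congr {c : Prog} {s s₁ s₂ : Store} {T T' : ℕ} (h : Runs c s T s₁) (hs : s₁ = s₂)
    (hT : T ≤ T') : Runs c s T' s₂ :=
  hs ▸ h.mono hT

theorem Runs.skip (s : Store) : Runs .skip s 1 s := ⟨1, le_rfl, .skip s⟩

theorem Runs.push (r : ℕ) (b : Bool) (s : Store) : Runs (.push r b) s 1 (update s r (b :: s r)) :=
  ⟨1, le_rfl, .push r b s⟩

theorem Runs.pop (r : ℕ) (s : Store) : Runs (.pop r) s 1 (update s r (s r).tail) :=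
  ⟨1, le_rfl, .pop r s⟩

theorem Runs.seq {a b : Prog} {s s₁ s₂ : Store} {m n : ℕ} (ha : Runs a s m s₁)
    (hb : Runs b s₁ n s₂) : Runs (.seq a b) s (m + n) s₂ := by
  obtain ⟨m', hm, ha⟩ := ha
  obtain ⟨n', hn, hb⟩ := hb
  exact ⟨m' + n', by omega, .seq ha hb⟩

theorem Runs.branchEmpty {r : ℕ} {a b c : Prog} {s s₁ : Store} {n : ℕ} (hr : s r = [])
    (h : Runs a s n s₁) : Runs (.branch r a b c) s (n + 1) s₁ := by
  obtain ⟨n', hn, h⟩ := h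
  exact ⟨n' + 1, by omega, .branchEmpty hr h⟩

theorem Runs.branchCons {r : ℕ} {a : Prog} {c : Bool → Prog} {s s₁ : Store} {n : ℕ} {x : Bool}
    {u : List Bool} (hr : s r = x :: u) (h : Runs (c x) s n s₁) :
    Runs (.branch r a (c false) (c true)) s (n + 1) s₁ := by
  obtain ⟨n', hn, h⟩ := h
  cases x
  · exact ⟨n' + 1, by omega, .branchFalse (by simp [hr]) h⟩
  · exact ⟨n' + 1, by omega, .branchTrue (by simp [hr]) h⟩

theorem Runs.branchFalse {r : ℕ} {a b c : Prog} {s s₁ : Store} {n : ℕ}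
    {u : List Bool} (hr : s r = false :: u) (h : Runs b s n s₁) :
    Runs (.branch r a b c) s (n + 1) s₁ := by
  obtain ⟨n', hn, h⟩ := h
  exact ⟨n' + 1, by omega, .branchFalse (by simp [hr]) h⟩

theorem Runs.branchTrue {r : ℕ} {a b c : Prog} {s s₁ : Store} {n : ℕ}
    {u : List Bool} (hr : s r = true :: u) (h : Runs c s n s₁) :
    Runs (.branch r a b c) s (n + 1) s₁ := by
  obtain ⟨n', hn, h⟩ := h
  exact ⟨n' + 1, by omega, .branchTrue (by simp [hr]) h⟩

theorem Runs.loopDone {r : ℕ} {a : Prog} {s : Store} (hr : s r = []) : Runs (.loop r a) s 1 s :=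
  ⟨1, le_rfl, .loopDone hr⟩

theorem Runs.loopStep {r : ℕ} {a : Prog} {s s₁ s₂ : Store} {m n : ℕ} (hr : s r ≠ [])
    (ha : Runs a s m s₁) (hl : Runs (.loop r a) s₁ n s₂) : Runs (.loop r a) s (m + n + 1) s₂ := by
  obtain ⟨m', hm, ha⟩ := ha
  obtain ⟨n', hn, hl⟩ := hl
  exact ⟨m' + n' + 1, by omega, .loopStep hr ha hl⟩

/-! ### Growth of the stacks and independence of unused stacks -/

/-- A step lengthens a stack by at most one bit. Running time therefore bounds the output size and
the cost of clearing up. -/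
theorem Exec.length_le {c : Prog} {s s' : Store} {n : ℕ} (h : Exec c s n s') (r : ℕ) :
    (s' r).length ≤ (s r).length + n := by
  induction h with
  | skip | loopDone => omega
  | push r' b s =>
    rcases eq_or_ne r r' with rfl | hr
    · simp
    · simp [hr]
  | pop r' s =>
    rcases eq_or_ne r r' with rfl | hr
    · simp; omega
    · simp [hr]
  | seq _ _ ih₁ ih₂ => omega
  | branchEmpty _ _ ih | branchFalse _ _ ih | branchTrue _ _ ih => omega
  | loopStep _ _ _ ih₁ ih₂ => omega

theorem Runs.length_le {c : Prog} {s s' : Store} {T : ℕ} (h : Runs c s T s') (r : ℕ) :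
    (s' r).length ≤ (s r).length + T := by
  obtain ⟨n, hn, h⟩ := h
  exact (h.length_le r).trans (by omega)

/-- All stacks that occur in the program are below this number. -/
def Prog.bound : Prog → ℕ
  | .skip => 0
  | .push r _ => r + 1
  | .pop r => r + 1
  | .seq a b => max a.bound b.bound
  | .branch r a b c => max (r + 1) (max a.bound (max b.bound c.bound))
  | .loop r a => max (r + 1) a.bound

/-- The stacks below `N` as in `s`, the others as in `z`. -/
def Store.mix (N : ℕ) (s z : Store) : Store := fun i => if i < N then s i else z i

theorem Store.mix_update {N r : ℕ} (hr : r < N) (s z : Store) (w : List Bool) :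
    Store.mix N (update s r w) z = update (Store.mix N s z) r w := by
  funext i
  by_cases hi : i = r
  · subst hi; simp [Store.mix, hr]
  · simp [Store.mix, hi]

theorem Store.mix_apply {N r : ℕ} (hr : r < N) (s z : Store) : Store.mix N s z r = s r := by
  simp [Store.mix, hr]

/-- A program neither reads nor writes a stack outside its bound, so data stored there survives a
run and does not influence it. -/
theorem Exec.frame {c : Prog} {s s' : Store} {n : ℕ} (h : Exec c s n s') {N : ℕ}
    (hN : c.bound ≤ N) (z : Store) : Exec c (Store.mix N s z) n (Store.mix N s' z) := by
  induction h with
  | skip => exact .skip _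
  | push r b s =>
    have hr : r < N := hN
    have := Exec.push r b (Store.mix N s z)
    rwa [Store.mix_apply hr, ← Store.mix_update hr] at this
  | pop r s =>
    have hr : r < N := hN
    have := Exec.pop r (Store.mix N s z)
    rwa [Store.mix_apply hr, ← Store.mix_update hr] at this
  | seq _ _ ih₁ ih₂ =>
    simp only [Prog.bound, max_le_iff] at hN
    exact .seq (ih₁ hN.1) (ih₂ hN.2)
  | branchEmpty hr _ ih =>
    simp only [Prog.bound, max_le_iff] at hN
    exact .branchEmpty (by rw [Store.mix_apply hN.1, hr]) (ih hN.2.1)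
  | branchFalse hr _ ih =>
    simp only [Prog.bound, max_le_iff] at hN
    exact .branchFalse (by rw [Store.mix_apply hN.1, hr]) (ih hN.2.2.1)
  | branchTrue hr _ ih =>
    simp only [Prog.bound, max_le_iff] at hN
    exact .branchTrue (by rw [Store.mix_apply hN.1, hr]) (ih hN.2.2.2)
  | loopDone hr =>
    simp only [Prog.bound, max_le_iff] at hN
    exact .loopDone (by rw [Store.mix_apply hN.1, hr])
  | loopStep hr _ _ ih₁ ih₂ =>
    have hN' := hN
    simp only [Prog.bound, max_le_iff] at hN'
    exact .loopStep (by rwa [Store.mix_apply hN'.1]) (ih₁ hN'.2) (ih₂ hN)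

/-! ### Basic programs -/

/-- Push the word `w` onto stack `d`. -/
def Prog.pushWord (d : ℕ) : List Bool → Prog
  | [] => .skip
  | b :: w => .seq (Prog.pushWord d w) (.push d b)

theorem Runs.pushWord (d : ℕ) (w : List Bool) (s : Store) :
    Runs (Prog.pushWord d w) s (w.length + 1) (update s d (w ++ s d)) := by
  induction w with
  | nil => simpa [Prog.pushWord] using Runs.skip s
  | cons b w ih =>
    have := ih.seq (Runs.push d b _)
    simpa [Prog.pushWord] using this

/-- Empty stack `r`, pushing `w b` onto `d` and `w' b` onto `d'` for every bit `b`. -/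
def Prog.spread (r d : ℕ) (w : Bool → List Bool) (d' : ℕ) (w' : Bool → List Bool) : Prog :=
  let body := fun b => .seq (.pop r) (.seq (Prog.pushWord d (w b)) (Prog.pushWord d' (w' b)))
  .loop r (.branch r .skip (body false) (body true))

/-- Popping and pushing reverses the order of the bits, hence `u.reverse`. A bit costs a loop test,
a branching test, a pop and two words of at most `K + 1` steps each, in total `2 * K + 5`. -/
theorem Runs.spread {r d d' : ℕ} (hd : d ≠ r) (hd' : d' ≠ r) (hdd : d' ≠ d)
    {w w' : Bool → List Bool} {K : ℕ} (hw : ∀ b, (w b).length ≤ K) (hw' : ∀ b, (w' b).length ≤ K)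
    {u : List Bool} {s : Store} (hu : s r = u) :
    Runs (Prog.spread r d w d' w') s ((2 * K + 5) * u.length + 1)
      (update (update (update s r []) d (u.reverse.flatMap w ++ s d)) d'
        (u.reverse.flatMap w' ++ s d')) := by
  induction u generalizing s with
  | nil =>
    have : update (update (update s r []) d (s d)) d' (s d') = s := by
      funext i
      simp only [update_apply]
      split_ifs <;> simp_all
    simpa [this, Prog.spread] using Runs.loopDone (r := r) hu
  | cons b u ih =>
    have h1 := (Runs.pop r s).seq ((Runs.pushWord d (w b) _).seq (Runs.pushWord d' (w' b) _))
    have h2 := Runs.branchCons (a := .skip)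
      (c := fun b => .seq (.pop r) (.seq (Prog.pushWord d (w b)) (Prog.pushWord d' (w' b)))) hu h1
    have h3 := ih (s := update (update (update s r u) d (w b ++ s d)) d' (w' b ++ s d'))
      (by simp [hd.symm, hd'.symm])
    simp only [hu, List.tail_cons, update_of_ne hd, update_of_ne hd', update_of_ne hdd] at h2
    have h4 := Runs.loopStep (by simp [hu]) h2 h3
    have e : update (update (update (update (update (update s r u) d (w b ++ s d)) d'
          (w' b ++ s d')) r []) d (u.reverse.flatMap w ++
            (update (update (update s r u) d (w b ++ s d)) d' (w' b ++ s d')) d)) d'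
          (u.reverse.flatMap w' ++
            (update (update (update s r u) d (w b ++ s d)) d' (w' b ++ s d')) d')
        = (update (update (update s r []) d ((b :: u).reverse.flatMap w ++ s d)) d'
        ((b :: u).reverse.flatMap w' ++ s d')) := by
      funext i
      simp only [update_apply, if_neg hdd, if_neg hdd.symm]
      split_ifs <;> simp_all [List.flatMap_append]
    rw [e] at h4
    refine h4.mono ?_
    have := hw b
    have := hw' b
    simp only [List.length_cons]
    ring_nf
    omega

/-- Move stack `r` onto stack `d`, reversing it. -/
def Prog.moveRev (r d : ℕ) : Prog :=
  .loop r (.branch r .skip (.seq (.pop r) (.push d false)) (.seq (.pop r) (.push d true)))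

theorem Runs.moveRev {r d : ℕ} (hd : d ≠ r) {u : List Bool} {s : Store} (hu : s r = u) :
    Runs (Prog.moveRev r d) s (4 * u.length + 1) (update (update s r []) d (u.reverse ++ s d)) := by
  induction u generalizing s with
  | nil =>
    have : update (update s r []) d (s d) = s := by
      funext i
      simp only [update_apply]
      split_ifs <;> simp_all
    simpa [this, Prog.moveRev] using Runs.loopDone (r := r) hu
  | cons b u ih =>
    have h2 := Runs.branchCons (a := .skip) (c := fun b => .seq (.pop r) (.push d b)) hu
      ((Runs.pop r s).seq (Runs.push d b _))
    have h3 := ih (s := update (update s r u) d (b :: s d)) (by simp [hd.symm])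
    simp only [hu, List.tail_cons, update_of_ne hd] at h2
    have h4 := Runs.loopStep (by simp [hu]) h2 h3
    have e : update (update (update (update s r u) d (b :: s d)) r []) d
        (u.reverse ++ (update (update s r u) d (b :: s d)) d)
        = update (update s r []) d ((b :: u).reverse ++ s d) := by
      funext i
      simp only [update_apply]
      split_ifs <;> simp_all
    rw [e] at h4
    refine h4.mono ?_
    simp only [List.length_cons]
    omega

/-- Empty stack `r`. -/
def Prog.clear (r : ℕ) : Prog := .loop r (.pop r)

theorem Runs.clear {r : ℕ} {u : List Bool} {s : Store} (hu : s r = u) :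
    Runs (Prog.clear r) s (2 * u.length + 1) (update s r []) := by
  induction u generalizing s with
  | nil =>
    have : update s r [] = s := by rw [← hu, update_eq_self]
    simpa [this, Prog.clear] using Runs.loopDone (r := r) hu
  | cons b u ih =>
    have hp := Runs.pop r s
    rw [hu, List.tail_cons] at hp
    have h := Runs.loopStep (by simp [hu]) hp (ih (s := update s r u) (by simp))
    rw [update_idem] at h
    exact h.mono (by simp only [List.length_cons]; omega)

/-- Empty the stacks `1, …, N`. -/
def Prog.clearUpTo : ℕ → Prog
  | 0 => .skip
  | N + 1 => .seq (Prog.clearUpTo N) (Prog.clear (N + 1))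

theorem Runs.clearUpTo (N : ℕ) {T : ℕ} {s : Store} (hT : ∀ i ≤ N, (s i).length ≤ T) :
    Runs (Prog.clearUpTo N) s ((2 * T + 1) * N + 1)
      (fun i => if 0 < i ∧ i ≤ N then [] else s i) := by
  induction N with
  | zero =>
    have : (fun i => if 0 < i ∧ i ≤ 0 then [] else s i) = s := by
      funext i; rw [if_neg (by omega)]
    rw [this]
    exact (Runs.skip s).mono (by simp)
  | succ N ih =>
    have h := (ih fun i hi => hT i (by omega)).seq (Runs.clear (r := N + 1) (u := s (N + 1)) (by simp))
    refine h.congr ?_ ?_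
    · funext i
      rcases eq_or_ne i (N + 1) with rfl | hi
      · simp
      · simp only [update_of_ne hi]
        congr 1
        simp only [eq_iff_iff]
        omega
    · have := hT (N + 1) le_rfl
      rw [mul_add_one]
      omega

/-! ### Pairs of strings -/

/-- Code of a pair of strings. -/
def pairCode (u v : List Bool) : List Bool := u.flatMap (fun b => [false, b]) ++ true :: v

theorem pairCode_nil (v : List Bool) : pairCode [] v = true :: v := rfl

/-- The marker `false` announces a bit of the first component and `true` ends that component, so the
code can be split in one pass. -/
theorem pairCode_cons (b : Bool) (u v : List Bool) :
    pairCode (b :: u) v = false :: b :: pairCode u v := rfl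

theorem pairCode_ne_nil (u v : List Bool) : pairCode u v ≠ [] := by simp [pairCode]

theorem length_pairCode (u v : List Bool) :
    (pairCode u v).length = 2 * u.length + 1 + v.length := by
  induction u with
  | nil => simp [pairCode_nil]; omega
  | cons b u ih => simp [pairCode_cons, ih]; omega

/-- Copy stack `0` to stack `N + 1`. -/
def Prog.copy (N : ℕ) : Prog :=
  .seq (Prog.moveRev 0 N) (Prog.spread N 0 (fun b => [b]) (N + 1) (fun b => [b]))

theorem Runs.copy {N : ℕ} (hN : N ≠ 0) {s : Store} (h : s N = []) (h' : s (N + 1) = []) :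
    Runs (Prog.copy N) s (11 * (s 0).length + 2) (update s (N + 1) (s 0)) := by
  have r₁ := Runs.moveRev (r := 0) (d := N) hN (u := s 0) (s := s) rfl
  have r₂ := Runs.spread (r := N) (d := 0) (d' := N + 1) (w := fun b => [b]) (w' := fun b => [b])
    (K := 1) hN.symm (by omega) (by omega) (by simp) (by simp)
    (s := update (update s 0 []) N ((s 0).reverse ++ s N)) (u := (s 0).reverse) (by simp [h])
  refine (r₁.seq r₂).congr ?_ (by simp only [List.length_reverse]; omega)
  funext i
  simp only [update_apply, List.reverse_reverse, List.flatMap_singleton']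
  split_ifs <;> simp_all

/-- Move stack `0` in reverse order to stack `N`, and stack `N + 1` to stack `0`. -/
def Prog.stash (N : ℕ) : Prog :=
  .seq (Prog.moveRev 0 N) (.seq (Prog.moveRev (N + 1) (N + 2)) (Prog.moveRev (N + 2) 0))

theorem Runs.stash {N : ℕ} (hN : N ≠ 0) {s : Store} (h : s N = []) (h' : s (N + 2) = []) :
    Runs (Prog.stash N) s (4 * (s 0).length + 8 * (s (N + 1)).length + 3)
      (update (update (update s (N + 1) []) N (s 0).reverse) 0 (s (N + 1))) := by
  have r₁ := Runs.moveRev (r := 0) (d := N) hN (u := s 0) (s := s) rfl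
  have r₂ := Runs.moveRev (r := N + 1) (d := N + 2) (by omega) (u := s (N + 1))
    (s := update (update s 0 []) N ((s 0).reverse ++ s N)) (by simp)
  have r₃ := Runs.moveRev (r := N + 2) (d := 0) (by omega) (u := (s (N + 1)).reverse)
    (s := update (update (update (update s 0 []) N ((s 0).reverse ++ s N)) (N + 1) []) (N + 2)
      ((s (N + 1)).reverse ++ (update (update s 0 []) N ((s 0).reverse ++ s N)) (N + 2)))
    (by simp [h'])
  refine (r₁.seq (r₂.seq r₃)).congr ?_ (by simp only [List.length_reverse]; omega)
  funext i
  simp only [update_apply, List.reverse_reverse]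
  split_ifs <;> simp_all

/-- Push the code of a pair onto stack `0`, whose first component is on stack `N` in reverse order
and whose second component is on stack `0`. -/
def Prog.pairUp (N : ℕ) : Prog :=
  .seq (.push 0 true) (Prog.spread N 0 (fun b => [false, b]) (N + 1) (fun _ => []))

theorem Runs.pairUp {N : ℕ} (hN : N ≠ 0) {s : Store} {u : List Bool} (h : s N = u.reverse) :
    Runs (Prog.pairUp N) s (9 * u.length + 2)
      (update (update s N []) 0 (pairCode u (s 0))) := by
  have r := Runs.spread (r := N) (d := 0) (d' := N + 1) (w := fun b => [false, b])
    (w' := fun _ => []) (K := 2) hN.symm (by omega) (by omega) (by simp) (by simp)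
    (s := update s 0 (true :: s 0)) (u := u.reverse) (by simp [hN, h])
  refine ((Runs.push 0 true s).seq r).congr ?_ (by simp only [List.length_reverse]; omega)
  funext i
  simp only [update_apply, List.reverse_reverse, pairCode]
  split_ifs <;> simp_all

/-- Split the code of a pair on stack `0`: the second component remains there, the first one is
moved in reverse order to `d`; stack `f` is a flag. -/
def Prog.unpair (d f : ℕ) : Prog :=
  .seq (.push f true) (.loop f (.branch 0 (.pop f)
    (.seq (.pop 0) (.branch 0 .skip (.seq (.pop 0) (.push d false)) (.seq (.pop 0) (.push d true))))
    (.seq (.pop 0) (.pop f))))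

theorem Runs.unpair {d f : ℕ} (hd : 0 < d) (hf : 0 < f) (hdf : d ≠ f) {u v : List Bool} {s : Store}
    (h0 : s 0 = pairCode u v) (hs : s f = []) :
    Runs (Prog.unpair d f) s (6 * u.length + 6)
      (update (update s 0 v) d (u.reverse ++ s d)) := by
  -- The flag stays nonempty until the end marker has been read. The induction needs arbitrary
  -- stores, since `d` fills up on the way.
  suffices H : ∀ (u : List Bool) (s : Store), s 0 = pairCode u v → s f = [true] →
      Runs (.loop f (.branch 0 (.pop f) (.seq (.pop 0)
        (.branch 0 .skip (.seq (.pop 0) (.push d false)) (.seq (.pop 0) (.push d true))))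
        (.seq (.pop 0) (.pop f)))) s (6 * u.length + 5)
        (update (update (update s f []) 0 v) d (u.reverse ++ s d)) by
    have h := (Runs.push f true s).seq (H u _ (by rwa [update_of_ne hf.ne]) (by simp [hs]))
    have e : update (update (update (update s f (true :: s f)) f []) 0 v) d
        (u.reverse ++ (update s f (true :: s f)) d)
        = update (update s 0 v) d (u.reverse ++ s d) := by
      funext i
      simp only [update_apply]
      split_ifs <;> simp_all
    rw [e] at h
    exact h.mono (by omega)
  intro u
  induction u with
  | nil =>
    intro s h0 hs
    have h := Runs.loopStep (r := f) (by simp [hs]) (Runs.branchTrue (a := .pop f) (b := (.seq (.pop 0)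
        (.branch 0 .skip (.seq (.pop 0) (.push d false)) (.seq (.pop 0) (.push d true)))))
        (h0.trans (pairCode_nil v)) ((Runs.pop 0 s).seq (Runs.pop f _)))
        (Runs.loopDone (r := f) (by simp [hf.ne', hs]))
    refine h.congr ?_ (by simp)
    rw [pairCode_nil] at h0
    funext i
    simp only [update_apply]
    split_ifs <;> simp_all
  | cons b u ih =>
    intro s h0 hs
    have h2 := Runs.branchCons (a := .skip) (c := fun b => .seq (.pop 0) (.push d b))
      (s := update s 0 (s 0).tail) (r := 0) (x := b) (u := pairCode u v)
      (by simp [h0, pairCode_cons]) ((Runs.pop 0 _).seq (Runs.push d b _))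
    have h3 := Runs.branchFalse (a := .pop f) (c := (.seq (.pop 0) (.pop f)))
      (h0.trans (pairCode_cons b u v)) ((Runs.pop 0 s).seq h2)
    have h4 := ih (update (update s 0 (pairCode u v)) d (b :: s d)) (by simp [hd.ne])
      (by simp [hf.ne', hdf.symm, hs])
    have e : update (update (update s 0 (s 0).tail) 0 (update s 0 (s 0).tail 0).tail) d
        (b :: (update (update s 0 (s 0).tail) 0 (update s 0 (s 0).tail 0).tail) d)
        = update (update s 0 (pairCode u v)) d (b :: s d) := by
      rw [pairCode_cons] at h0
      funext i
      simp only [update_apply]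
      split_ifs <;> simp_all
    rw [e] at h3
    refine (Runs.loopStep (by simp [hs]) h3 h4).congr ?_
      (by simp only [List.length_cons]; omega)
    funext i
    simp only [update_apply]
    split_ifs <;> simp_all

/-! ### Data types coded by bit strings -/

/-- Types whose elements are coded by bit strings. -/
class Code (α : Type) where
  /-- The code of an element. -/
  enc : α → List Bool

open Code

/-- Bit strings that are coded by themselves. -/
structure RawString : Type where
  bits : List Bool

instance : Code Unit := ⟨fun _ => []⟩
instance : Code Bool := ⟨fun b => [b]⟩
-- In unary, the size of a number is the number itself, and a loop on its code can serve as a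
-- counter.
instance : Code ℕ := ⟨fun n => List.replicate n true⟩
-- This is the format of the machine's inputs, whereas a `List Bool` is coded as a list, with three
-- bits for each entry.
instance : Code RawString := ⟨RawString.bits⟩
instance {α β : Type} [Code α] [Code β] : Code (α × β) := ⟨fun p => pairCode (enc p.1) (enc p.2)⟩
-- A nonempty list has the code of the pair of its head and its tail. Codes of pairs are never
-- empty, so one branching test recognizes the empty list.
instance {α : Type} [Code α] : Code (List α) := ⟨fun l => l.foldr (fun a w => pairCode (enc a) w) []⟩

section

variable {α β γ δ σ : Type} [Code α] [Code β] [Code γ] [Code δ] [Code σ]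

theorem enc_pair (a : α) (b : β) : enc (a, b) = pairCode (enc a) (enc b) := rfl
theorem enc_nil : enc ([] : List α) = [] := rfl
theorem enc_cons (a : α) (l : List α) : enc (a :: l) = pairCode (enc a) (enc l) := rfl

/-- The length of the code. -/
def size (a : α) : ℕ := (enc a).length

theorem size_pair (a : α) (b : β) : size (a, b) = 2 * size a + 1 + size b :=
  length_pairCode _ _

theorem size_nil : size ([] : List α) = 0 := rfl

theorem size_cons (a : α) (l : List α) : size (a :: l) = 2 * size a + 1 + size l :=
  length_pairCode _ _

theorem size_nat (n : ℕ) : size n = n := List.length_replicate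

theorem size_bool (b : Bool) : size b = 1 := rfl

theorem size_append (l l' : List α) : size (l ++ l') = size l + size l' := by
  induction l with
  | nil => simp [size_nil]
  | cons a l ih => simp only [List.cons_append, size_cons, ih]; ring

theorem size_reverse (l : List α) : size l.reverse = size l := by
  induction l with
  | nil => rfl
  | cons a l ih => simp only [List.reverse_cons, size_append, size_cons, ih, size_nil]; ring

theorem size_le_of_mem {a : α} {l : List α} (h : a ∈ l) : size a ≤ size l := by
  induction l with
  | nil => simp at h
  | cons b l ih =>
    rw [size_cons]
    rcases List.mem_cons.1 h with rfl | h
    · omega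
    · have := ih h; omega

theorem length_le_size (l : List α) : l.length ≤ size l := by
  induction l with
  | nil => simp
  | cons a l ih => rw [size_cons, List.length_cons]; omega

theorem size_bits (l : List Bool) : size l = 3 * l.length := by
  induction l with
  | nil => rfl
  | cons a l ih => rw [size_cons, List.length_cons, size_bool, ih]; ring

theorem size_le_of_suffix {l l' : List α} (h : l <:+ l') : size l ≤ size l' := by
  obtain ⟨u, rfl⟩ := h
  rw [size_append]
  omega

/-! ### Polynomial bounds -/

theorem eval_mono (q : Polynomial ℕ) {m n : ℕ} (h : m ≤ n) : q.eval m ≤ q.eval n := by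
  simp only [Polynomial.eval_eq_sum, Polynomial.sum]
  gcongr

/-- Bounded by a polynomial in the size of the argument. -/
def PolyBounded (g : α → ℕ) : Prop := ∃ q : Polynomial ℕ, ∀ a, g a ≤ q.eval (size a)

namespace PolyBounded

theorem mono {g g' : α → ℕ} (h : PolyBounded g') (hg : ∀ a, g a ≤ g' a) : PolyBounded g :=
  let ⟨q, hq⟩ := h
  ⟨q, fun a => (hg a).trans (hq a)⟩

theorem const (n : ℕ) : PolyBounded (fun _ : α => n) := ⟨Polynomial.C n, by simp⟩

theorem size' : PolyBounded (fun a : α => size a) := ⟨Polynomial.X, by simp⟩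

theorem add {g g' : α → ℕ} (h : PolyBounded g) (h' : PolyBounded g') :
    PolyBounded (fun a => g a + g' a) := by
  obtain ⟨q, hq⟩ := h
  obtain ⟨q', hq'⟩ := h'
  exact ⟨q + q', fun a => by simpa using add_le_add (hq a) (hq' a)⟩

theorem mul {g g' : α → ℕ} (h : PolyBounded g) (h' : PolyBounded g') :
    PolyBounded (fun a => g a * g' a) := by
  obtain ⟨q, hq⟩ := h
  obtain ⟨q', hq'⟩ := h'
  exact ⟨q * q', fun a => by simpa using mul_le_mul' (hq a) (hq' a)⟩

theorem eval {g : α → ℕ} (h : PolyBounded g) (p : Polynomial ℕ) :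
    PolyBounded (fun a => p.eval (g a)) := by
  obtain ⟨q, hq⟩ := h
  exact ⟨p.comp q, fun a => by simpa using eval_mono p (hq a)⟩

theorem comp {g : β → ℕ} (hg : PolyBounded g) {f : α → β} (hf : PolyBounded (fun a => size (f a))) :
    PolyBounded (fun a => g (f a)) :=
  let ⟨q, hq⟩ := hg
  (hf.eval q).mono fun a => hq (f a)

end PolyBounded

/-! ### Functions computable in polynomial time -/

/-- Some program replaces the code of `a` on stack `0` by the code of `f a`, in polynomial time; it
needs finitely many other stacks to be empty, and restores all of them. -/
@[fun_prop]
def PolyTime (f : α → β) : Prop :=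
  ∃ (c : Prog) (N : ℕ) (T : α → ℕ), PolyBounded T ∧ ∀ (a : α) (s : Store), s 0 = enc a →
    (∀ i, 0 < i → i < N → s i = []) → Runs c s (T a) (update s 0 (enc (f a)))

namespace PolyTime

/-- Output is written one bit per step. This bound is what makes composition possible. -/
theorem polyBounded {f : α → β} (hf : PolyTime f) : PolyBounded (fun a => size (f a)) := by
  obtain ⟨c, N, T, hT, h⟩ := hf
  refine (PolyBounded.size'.add hT).mono fun a => ?_
  have := (h a (update (fun _ => []) 0 (enc a)) (by simp)
    fun i hi _ => by simp [hi.ne']).length_le 0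
  simpa [size] using this

@[fun_prop]
theorem id : PolyTime (fun a : α => a) :=
  ⟨.skip, 0, _, .const 1, fun a s hs _ => by
    simpa only [← hs, update_eq_self] using Runs.skip s⟩

@[fun_prop]
theorem const (b : β) : PolyTime (fun _ : α => b) :=
  ⟨.seq (Prog.clear 0) (Prog.pushWord 0 (enc b)), 0, _,
    (((PolyBounded.const 2).mul .size').add (.const 1)).add (.const ((enc b).length + 1)),
    fun a s hs _ => by
      simpa [size] using (Runs.clear hs).seq (Runs.pushWord 0 (enc b) _)⟩

@[fun_prop]
-- Both programs may use the same scratch stacks, as the first one leaves them empty. The second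
-- runs in time polynomial in `size (f a)`, which is polynomial in `size a`.
theorem comp {g : β → γ} {f : α → β} (hg : PolyTime g) (hf : PolyTime f) :
    PolyTime (fun a => g (f a)) := by
  have hb := hf.polyBounded
  obtain ⟨c, N, T, hT, h⟩ := hf
  obtain ⟨c', N', T', hT', h'⟩ := hg
  refine ⟨.seq c c', max N N', _, hT.add (hT'.comp hb), fun a s hs hN => ?_⟩
  have h₁ := h a s hs fun i hi hi' => hN i hi (lt_max_of_lt_left hi')
  have h₂ := h' (f a) (update s 0 (enc (f a))) (by simp) fun i hi hi' => by
    rw [update_of_ne hi.ne']; exact hN i hi (lt_max_of_lt_right hi')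
  simpa using h₁.seq h₂

@[fun_prop]
-- While `c` runs, a copy of the input waits on stack `N + 1`; while `c'` runs, the first value
-- waits on stack `N`.
theorem pair {f : α → β} {g : α → γ} (hf : PolyTime f) (hg : PolyTime g) :
    PolyTime (fun a => (f a, g a)) := by
  have hb := hf.polyBounded
  obtain ⟨c, M, T, hT, h⟩ := hf
  obtain ⟨c', M', T', hT', h'⟩ := hg
  -- Stack `N` lies beyond the scratch stacks of both programs.
  let N := M + M' + 1
  have hN0 : N ≠ 0 := by omega
  refine ⟨.seq (Prog.copy N) (.seq c (.seq (Prog.stash N) (.seq c' (Prog.pairUp N)))), N + 3,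
    fun a => (11 * size a + 2) + (T a + ((4 * size (f a) + 8 * size a + 3) + (T' a +
      (9 * size (f a) + 2)))), ?_, fun a s hs hN => ?_⟩
  · have hs (n m : ℕ) : PolyBounded (fun a : α => n * size a + m) :=
      ((PolyBounded.const n).mul .size').add (.const m)
    have hf (n m : ℕ) : PolyBounded (fun a : α => n * size (f a) + m) :=
      ((PolyBounded.const n).mul hb).add (.const m)
    exact ((hs 11 2).add (hT.add (((hf 4 0).add (hs 8 3)).add (hT'.add (hf 9 2)))))
  have hsN := hN N (by omega) (by omega)
  have hsN1 := hN (N + 1) (by omega) (by omega)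
  have hsN2 := hN (N + 2) (by omega) (by omega)
  have r₁ := Runs.copy hN0 hsN hsN1
  rw [hs] at r₁
  have r₂ := h a (update s (N + 1) (enc a)) (by simp [hs]) fun i hi hi' => by
    rw [update_of_ne (by omega)]; exact hN i hi (by omega)
  have r₃ := Runs.stash hN0 (s := update (update s (N + 1) (enc a)) 0 (enc (f a)))
    (by simp [hN0, hsN]) (by simp [hsN2])
  have e₃ : update (update (update (update (update s (N + 1) (enc a)) 0 (enc (f a))) (N + 1) []) N
      (update (update s (N + 1) (enc a)) 0 (enc (f a)) 0).reverse) 0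
      (update (update s (N + 1) (enc a)) 0 (enc (f a)) (N + 1))
      = update s N (enc (f a)).reverse := by
    funext i
    simp only [update_apply]
    split_ifs <;> simp_all
  rw [e₃] at r₃
  have r₄ := h' a (update s N (enc (f a)).reverse) (by simp [hN0.symm, hs]) fun i hi hi' => by
    rw [update_of_ne (by omega)]; exact hN i hi (by omega)
  have r₅ := Runs.pairUp hN0 (s := update (update s N (enc (f a)).reverse) 0 (enc (g a)))
    (u := enc (f a)) (by simp [hN0])
  refine (r₁.seq (r₂.seq (r₃.seq (r₄.seq r₅)))).congr ?_ (by simp [size])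
  funext i
  simp only [update_apply, enc_pair]
  split_ifs <;> simp_all

/-- Continue with two values, the second one on stack `0`, the first one reversed on stack `N`. -/
theorem of_pair {x : α → β} {y : α → γ} {f : α → δ} (hx : PolyTime x) (hy : PolyTime y)
    (c : Prog) (N M : ℕ) (T : α → ℕ) (hN : 0 < N) (hNM : N < M) (hT : PolyBounded T)
    (h : ∀ a s, s 0 = enc (y a) → s N = (enc (x a)).reverse →
      (∀ i, 0 < i → i < M → i ≠ N → s i = []) →
      Runs c s (T a) (update (update s N []) 0 (enc (f a)))) : PolyTime f := by
  have hb := hx.polyBounded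
  obtain ⟨c₁, M₁, T₁, hT₁, h₁⟩ := hx.pair hy
  refine ⟨.seq c₁ (.seq (Prog.unpair N M) c), max M₁ (M + 1), _,
    hT₁.add ((((PolyBounded.const 6).mul hb).add (.const 6)).add hT), fun a s hs hM => ?_⟩
  have hM' : ∀ i, 0 < i → i < M + 1 → s i = [] := fun i hi hi' => hM i hi (lt_max_of_lt_right hi')
  have r₁ := h₁ a s hs fun i hi hi' => hM i hi (lt_max_of_lt_left hi')
  have r₂ := Runs.unpair hN (by omega) hNM.ne (s := update s 0 (enc (x a, y a))) (u := enc (x a))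
    (v := enc (y a)) (by simp [enc_pair]) (by rw [update_of_ne (by omega)]; exact hM' M (by omega) (by omega))
  have e : update (update (update s 0 (enc (x a, y a))) 0 (enc (y a))) N
      ((enc (x a)).reverse ++ update s 0 (enc (x a, y a)) N)
      = update (update s 0 (enc (y a))) N (enc (x a)).reverse := by
    simp [hN.ne', hM' N hN (by omega)]
  rw [e] at r₂
  have r₃ := h a (update (update s 0 (enc (y a))) N (enc (x a)).reverse) (by simp [hN.ne])
    (by simp) fun i hi hi' hiN => by
      rw [update_of_ne hiN, update_of_ne hi.ne']; exact hM' i hi (by omega)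
  refine (r₁.seq (r₂.seq r₃)).congr ?_ le_rfl
  have := hM' N hN (by omega)
  funext i
  simp only [update_apply]
  split_ifs <;> simp_all

@[fun_prop]
theorem fst {f : α → β × γ} (hf : PolyTime f) : PolyTime (fun a => (f a).1) := by
  suffices H : PolyTime (fun p : β × γ => p.1) from H.comp hf
  refine ⟨.seq (Prog.unpair 1 2) (.seq (Prog.clear 0) (Prog.moveRev 1 0)), 3, fun p =>
    (6 * size p + 6) + ((2 * size p + 1) + (4 * size p + 1)),
    ((((PolyBounded.const 6).mul .size').add (.const 6)).add
      ((((PolyBounded.const 2).mul .size').add (.const 1)).add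
      (((PolyBounded.const 4).mul .size').add (.const 1)))), fun p s hs hN => ?_⟩
  have h1 := hN 1 (by omega) (by omega)
  have r₁ := Runs.unpair (d := 1) (f := 2) (by omega) (by omega) (by omega) (u := enc p.1)
    (v := enc p.2) hs (hN 2 (by omega) (by omega))
  rw [h1, List.append_nil] at r₁
  have r₂ := Runs.clear (r := 0) (s := update (update s 0 (enc p.2)) 1 (enc p.1).reverse)
    (u := enc p.2) (by simp)
  have r₃ := Runs.moveRev (r := 1) (d := 0) (by omega) (u := (enc p.1).reverse)
    (s := update (update (update s 0 (enc p.2)) 1 (enc p.1).reverse) 0 []) (by simp)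
  have := size_pair p.1 p.2
  rw [Prod.mk.eta] at this
  refine (r₁.seq (r₂.seq r₃)).congr ?_ (by simp only [size, List.length_reverse] at this ⊢; omega)
  funext i
  simp only [update_apply]
  split_ifs <;> simp_all

@[fun_prop]
theorem snd {f : α → β × γ} (hf : PolyTime f) : PolyTime (fun a => (f a).2) := by
  suffices H : PolyTime (fun p : β × γ => p.2) from H.comp hf
  refine ⟨.seq (Prog.unpair 1 2) (Prog.clear 1), 3, fun p =>
    (6 * size p + 6) + (2 * size p + 1),
    ((((PolyBounded.const 6).mul .size').add (.const 6)).add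
      (((PolyBounded.const 2).mul .size').add (.const 1))), fun p s hs hN => ?_⟩
  have h1 := hN 1 (by omega) (by omega)
  have r₁ := Runs.unpair (d := 1) (f := 2) (by omega) (by omega) (by omega) (u := enc p.1)
    (v := enc p.2) hs (hN 2 (by omega) (by omega))
  rw [h1, List.append_nil] at r₁
  have r₂ := Runs.clear (r := 1) (s := update (update s 0 (enc p.2)) 1 (enc p.1).reverse)
    (u := (enc p.1).reverse) (by simp)
  have := size_pair p.1 p.2
  rw [Prod.mk.eta] at this
  refine (r₁.seq r₂).congr ?_ (by simp only [size, List.length_reverse] at this ⊢; omega)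
  funext i
  simp only [update_apply]
  split_ifs <;> simp_all

@[fun_prop]
theorem cond {p : α → Bool} {f g : α → β} (hp : PolyTime p) (hf : PolyTime f) (hg : PolyTime g) :
    PolyTime (fun a => cond (p a) (f a) (g a)) := by
  obtain ⟨c, M, T, hT, h⟩ := hf
  obtain ⟨c', M', T', hT', h'⟩ := hg
  let N := M + M' + 1
  refine of_pair hp id (.branch N .skip (.seq (.pop N) c') (.seq (.pop N) c)) N (N + 1)
    (fun a => 1 + (T a + T' a) + 1) (by omega) (by omega)
    (((PolyBounded.const 1).add (hT.add hT')).add (.const 1)) fun a s hs hN hM => ?_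
  have hM' : ∀ i, 0 < i → i < N → update s N [] i = [] := fun i hi hi' => by
    rw [update_of_ne hi'.ne]; exact hM i hi (by omega) hi'.ne
  have rp := Runs.pop N s
  have ep : (s N).tail = [] := by rw [hN]; rfl
  rw [ep] at rp
  cases hpa : p a
  · have r := rp.seq (h' a _ (by simp [N, hs]) fun i hi hi' => hM' i hi (by omega))
    exact (Runs.branchFalse (u := []) (by rw [hN, hpa]; rfl) r).mono (by omega)
  · have r := rp.seq (h a _ (by simp [N, hs]) fun i hi hi' => hM' i hi (by omega))
    exact (Runs.branchTrue (u := []) (by rw [hN, hpa]; rfl) r).mono (by omega)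

/-- The unary counter on stack `N` loses a bit in each round. Without the bound `B` the sizes could
grow exponentially, for instance by repeated doubling. The last iterate needs no bound, as `F` is
not applied to it. -/
theorem iterate {n : α → ℕ} {x : α → β} {F : β → β} (hn : PolyTime n) (hx : PolyTime x)
    (hF : PolyTime F) {B : α → ℕ} (hB : PolyBounded B)
    (hFB : ∀ a, ∀ i < n a, size (F^[i] (x a)) ≤ B a) : PolyTime (fun a => F^[n a] (x a)) := by
  have hb : PolyBounded n := hn.polyBounded.mono fun a => by rw [size_nat]
  obtain ⟨c, M, T, ⟨q, hq⟩, h⟩ := hF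
  let N := M + 1
  refine of_pair hn hx (.loop N (.seq (.pop N) c)) N (N + 1)
    (fun a => (q.eval (B a) + 2) * n a + 1) (by omega) (by omega)
    ((((hB.eval q).add (.const 2)).mul hb).add (.const 1)) fun a s hs hN hM => ?_
  have H : ∀ (m : ℕ) (y : β) (s : Store), s 0 = enc y → s N = List.replicate m true →
      (∀ i, 0 < i → i < N → s i = []) → (∀ i < m, size (F^[i] y) ≤ B a) →
      Runs (.loop N (.seq (.pop N) c)) s ((q.eval (B a) + 2) * m + 1)
        (update (update s N []) 0 (enc (F^[m] y))) := by
    intro m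
    induction m with
    | zero =>
      intro y s hs hN _ _
      refine (Runs.loopDone hN).congr ?_ (by omega)
      funext i
      simp only [update_apply]
      split_ifs <;> simp_all
    | succ m ih =>
      intro y s hs hN hM hB
      have rp := Runs.pop N s
      have ep : (s N).tail = List.replicate m true := by rw [hN]; rfl
      rw [ep] at rp
      have r₁ := h y (update s N (List.replicate m true)) (by simp [N, hs]) fun i hi hi' => by
        rw [update_of_ne (by omega)]; exact hM i hi (by omega)
      have r₂ := ih (F y) (update (update s N (List.replicate m true)) 0 (enc (F y))) (by simp)
        (by simp [N]) (fun i hi hi' => by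
          rw [update_of_ne hi.ne', update_of_ne hi'.ne]; exact hM i hi hi')
        fun i hi => by simpa using hB (i + 1) (by omega)
      refine (Runs.loopStep (by simp [hN, List.replicate_succ]) (rp.seq r₁) r₂).congr ?_ ?_
      · funext i
        simp only [update_apply, iterate_succ_apply]
        split_ifs <;> simp_all
      · have := (hq y).trans (eval_mono q (hB 0 (by omega)))
        simp only [mul_add, mul_one]
        omega
  have := H (n a) (x a) s hs (by simpa [enc] using hN) (fun i hi hi' => hM i hi (by omega) hi'.ne)
    (hFB a)
  exact this

end PolyTime
end
section

variable {α β γ δ σ : Type} [Code α] [Code β] [Code γ] [Code δ] [Code σ]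

namespace PolyTime

/-! ### Lists, numbers and raw strings -/

/-- If the code does not change, the program that does nothing computes the function. -/
theorem recode (f : α → β) (h : ∀ a, enc (f a) = enc a) : PolyTime f :=
  ⟨.skip, 0, _, .const 1, fun a s hs _ => by
    simpa only [h, ← hs, update_eq_self] using Runs.skip s⟩

@[fun_prop]
theorem cons {f : α → β} {g : α → List β} (hf : PolyTime f) (hg : PolyTime g) :
    PolyTime (fun a => f a :: g a) :=
  (recode (fun p : β × List β => p.1 :: p.2) fun _ => rfl).comp (hf.pair hg)

/-- The code of a nonempty list already is the required pair; only the empty list has to be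
replaced. -/
theorem headD_tail (d : β) : PolyTime (fun l : List β => (l.headD d, l.tail)) := by
  refine ⟨.branch 0 (Prog.pushWord 0 (enc (d, ([] : List β)))) .skip .skip, 0, _,
    .const ((enc (d, ([] : List β))).length + 2), fun l s hs _ => ?_⟩
  cases l with
  | nil =>
    have := Runs.branchEmpty (b := .skip) (c := .skip) hs
      (Runs.pushWord 0 (enc (d, ([] : List β))) s)
    rw [hs] at this
    simpa [enc_nil] using this
  | cons b l =>
    obtain ⟨x, u, hu⟩ := List.exists_cons_of_ne_nil (pairCode_ne_nil (enc b) (enc l))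
    have := Runs.branchCons (a := Prog.pushWord 0 (enc (d, ([] : List β)))) (c := fun _ => .skip)
      (hs.trans hu) (Runs.skip s)
    refine this.congr ?_ (by omega)
    simp only [List.headD_cons, List.tail_cons, enc_pair, ← enc_cons, ← hs, update_eq_self]

@[fun_prop]
theorem headD {l : α → List β} (hl : PolyTime l) (d : β) : PolyTime (fun a => (l a).headD d) :=
  fst ((headD_tail d).comp hl)

@[fun_prop]
theorem tail [Inhabited β] {l : α → List β} (hl : PolyTime l) : PolyTime (fun a => (l a).tail) :=
  -- The default head is discarded.
  snd ((headD_tail default).comp hl)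

@[fun_prop]
theorem isEmpty {l : α → List β} (hl : PolyTime l) : PolyTime (fun a => (l a).isEmpty) := by
  suffices H : PolyTime (fun l : List β => l.isEmpty) from H.comp hl
  refine ⟨.branch 0 (.push 0 true) (.seq (.clear 0) (.push 0 false))
    (.seq (.clear 0) (.push 0 false)), 0, fun l => 2 * size l + 3,
    ((PolyBounded.const 2).mul .size').add (.const 3), fun l s hs _ => ?_⟩
  cases l with
  | nil =>
    refine (Runs.branchEmpty hs (Runs.push 0 true s)).congr ?_ (by simp only; omega)
    rw [hs]
    rfl
  | cons b l =>
    obtain ⟨x, u, hu⟩ := List.exists_cons_of_ne_nil (pairCode_ne_nil (enc b) (enc l))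
    have := Runs.branchCons (a := .push 0 true) (c := fun _ => .seq (.clear 0) (.push 0 false))
      (hs.trans hu) ((Runs.clear hs).seq (Runs.push 0 false _))
    refine this.congr ?_ (by simp only [size]; omega)
    simp [enc]

/-- `pairCode [] v` is `true :: v`, so unary numbers and lists of units have the same codes.
Arithmetic is thereby reduced to operations on lists. -/
theorem enc_replicate_unit (n : ℕ) : enc (List.replicate n ()) = enc n := by
  induction n with
  | zero => rfl
  | succ n ih => rw [List.replicate_succ, enc_cons, ih]; rfl

theorem replicate_unit : PolyTime (fun n : ℕ => List.replicate n ()) := recode _ enc_replicate_unit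

theorem length_unit : PolyTime (fun l : List Unit => l.length) :=
  recode _ fun l => by
    rw [← enc_replicate_unit]
    congr
    exact (List.eq_replicate_iff.2 ⟨rfl, fun _ _ => rfl⟩).symm

@[fun_prop]
theorem succ {n : α → ℕ} (hn : PolyTime n) : PolyTime (fun a => n a + 1) := by
  have := length_unit.comp ((const ()).cons (replicate_unit.comp hn))
  simpa using this

theorem beq_zero {n : α → ℕ} (hn : PolyTime n) : PolyTime (fun a => n a == 0) := by
  have := (replicate_unit.comp hn).isEmpty
  convert this using 2 with a
  rcases n a with - | k <;> simp [List.replicate_succ]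

@[fun_prop]
theorem size' {f : α → β} (hf : PolyTime f) : PolyTime (fun a => size (f a)) := by
  suffices H : PolyTime (fun b : β => size b) from H.comp hf
  refine ⟨.seq (Prog.moveRev 0 1) (Prog.spread 1 0 (fun _ => [true]) 2 (fun _ => [])), 3,
    fun b => 11 * size b + 2, ((PolyBounded.const 11).mul .size').add (.const 2),
    fun b s hs hN => ?_⟩
  have h1 := hN 1 (by omega) (by omega)
  have r₁ := Runs.moveRev (d := 1) (by omega) hs
  have r₂ := Runs.spread (r := 1) (d := 0) (d' := 2) (w := fun _ => [true]) (w' := fun _ => [])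
    (K := 1) (by omega) (by omega) (by omega) (by simp) (by simp) (u := (enc b).reverse)
    (s := update (update s 0 []) 1 ((enc b).reverse ++ s 1)) (by simp [h1])
  refine (r₁.seq r₂).congr ?_ (by simp only [List.length_reverse, size]; omega)
  have h (u : List Bool) : u.flatMap (fun _ => [true]) = List.replicate u.length true := by
    induction u with
    | nil => rfl
    | cons b u ih => simp [ih, List.replicate_succ]
  funext i
  simp only [update_apply, List.reverse_reverse, h]
  split_ifs <;> simp_all [enc, size]

theorem enc_bits (l : List Bool) : enc l = l.flatMap fun b => [false, b, true] := by
  induction l with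
  | nil => rfl
  | cons b l ih => rw [enc_cons, ih]; rfl

@[fun_prop]
theorem bits {f : α → RawString} (hf : PolyTime f) : PolyTime (fun a => (f a).bits) := by
  suffices H : PolyTime (fun r : RawString => r.bits) from H.comp hf
  refine ⟨.seq (Prog.moveRev 0 1) (Prog.spread 1 0 (fun b => [false, b, true]) 2 (fun _ => [])), 3,
    fun r => 15 * size r + 2, ((PolyBounded.const 15).mul .size').add (.const 2),
    fun r s hs hN => ?_⟩
  have h1 := hN 1 (by omega) (by omega)
  have r₁ := Runs.moveRev (d := 1) (by omega) hs
  have r₂ := Runs.spread (r := 1) (d := 0) (d' := 2) (w := fun b => [false, b, true])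
    (w' := fun _ => []) (K := 3) (by omega) (by omega) (by omega) (by simp) (by simp)
    (u := (enc r).reverse) (s := update (update s 0 []) 1 ((enc r).reverse ++ s 1)) (by simp [h1])
  refine (r₁.seq r₂).congr ?_ (by simp only [List.length_reverse, size]; omega)
  funext i
  simp only [update_apply, List.reverse_reverse, enc_bits]
  split_ifs <;> simp_all [enc]

@[fun_prop]
theorem rawString {f : α → List Bool} (hf : PolyTime f) :
    PolyTime (fun a => RawString.mk (f a)) := by
  suffices H : PolyTime (fun l : List Bool => RawString.mk l) from H.comp hf
  -- An entry `b` is coded by `false, b, true`: the loop pops the first marker, and the body pops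
  -- `b` and the second marker and keeps `b`.
  let body : Bool → Prog := fun b => .seq (.pop 0) (.seq (.pop 0) (.push 1 b))
  refine ⟨.seq (.loop 0 (.seq (.pop 0) (.branch 0 .skip (body false) (body true))))
    (Prog.moveRev 1 0), 2, fun l => 6 * size l + 2,
    ((PolyBounded.const 6).mul .size').add (.const 2), fun l s hs hN => ?_⟩
  have H : ∀ (l : List Bool) (s : Store), s 0 = enc l →
      Runs (.loop 0 (.seq (.pop 0) (.branch 0 .skip (body false) (body true)))) s
        (6 * l.length + 1) (update (update s 0 []) 1 (l.reverse ++ s 1)) := by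
    intro l
    induction l with
    | nil =>
      intro s hs
      refine (Runs.loopDone hs).congr ?_ (by simp)
      rw [enc_nil] at hs
      funext i
      simp only [update_apply]
      split_ifs <;> simp_all
    | cons b l ih =>
      intro s hs
      have e : s 0 = false :: b :: true :: enc l := hs
      have hb := (Runs.pop 0 (update s 0 (b :: true :: enc l))).seq
        ((Runs.pop 0 _).seq (Runs.push 1 b _))
      have rb := Runs.branchCons (a := .skip) (c := body) (r := 0) (x := b)
        (s := update s 0 (b :: true :: enc l))
        (u := true :: enc l) (by simp) hb
      have rp := Runs.pop 0 s
      rw [e, List.tail_cons] at rp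
      have r := Runs.loopStep (by simp [e]) (rp.seq rb) (ih _ (by simp))
      refine r.congr ?_ (by simp only [List.length_cons]; omega)
      funext i
      simp only [update_apply]
      split_ifs <;> simp_all
  have h1 := hN 1 (by omega) (by omega)
  have r₁ := H l s hs
  have r₂ := Runs.moveRev (r := 1) (d := 0) (by omega) (u := l.reverse)
    (s := update (update s 0 []) 1 (l.reverse ++ s 1)) (by simp [h1])
  refine (r₁.seq r₂).congr ?_ ?_
  · funext i
    simp only [update_apply]
    split_ifs <;> simp_all [enc]
  · simp only [size_bits, List.length_reverse]; omega

/-! ### Programs with several inputs -/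

/-- An arbitrary program may leave rubbish behind. Its inputs are placed on stacks `0` and `1`, it
runs unaffected by the stacks from `N` on, and then the stacks `1, …, N - 1` are emptied; this is
affordable since their lengths are bounded by input size plus running time. -/
theorem of_program {x : α → γ} {y : α → δ} {f : α → β} (hx : PolyTime x) (hy : PolyTime y)
    (c : Prog) {T : α → ℕ} (hT : PolyBounded T)
    (h : ∀ a, OutputsWithin c [enc (x a), enc (y a)] (T a) (enc (f a))) : PolyTime f := by
  have hbx := hx.polyBounded
  have hby := hy.polyBounded
  -- The summand `2` keeps stack `N`, which holds the first input, apart from the input stacks `0`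
  -- and `1`.
  let N := c.bound + 2
  let L : α → ℕ := fun a => size (x a) + size (y a) + T a
  refine of_pair hx hy (.seq (Prog.moveRev 0 (N + 1)) (.seq (Prog.moveRev (N + 1) 1)
    (.seq (Prog.moveRev N 0) (.seq c (Prog.clearUpTo (N - 1)))))) N (N + 2)
    (fun a => (4 * L a + 1) + ((4 * L a + 1) + ((4 * L a + 1) + (T a + ((2 * L a + 1) * N + 1)))))
    (by omega) (by omega) ?_ fun a s hs hsN hN => ?_
  · have hL : PolyBounded L := (hbx.add hby).add hT
    have h4 := ((PolyBounded.const 4).mul hL).add (.const 1)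
    exact h4.add (h4.add (h4.add (hT.add (((((PolyBounded.const 2).mul hL).add (.const 1)).mul
      (.const N)).add (.const 1)))))
  have h1 := hN 1 (by omega) (by omega) (by omega)
  have hN1 := hN (N + 1) (by omega) (by omega) (by omega)
  have r₁ := Runs.moveRev (r := 0) (d := N + 1) (by omega) hs
  have r₂ := Runs.moveRev (r := N + 1) (d := 1) (by omega) (u := (enc (y a)).reverse)
    (s := update (update s 0 []) (N + 1) ((enc (y a)).reverse ++ s (N + 1))) (by simp [hN1])
  have r₃ := Runs.moveRev (r := N) (d := 0) (by omega) (u := (enc (x a)).reverse)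
    (s := update (update (update (update s 0 []) (N + 1) ((enc (y a)).reverse ++ s (N + 1)))
      (N + 1) []) 1 ((enc (y a)).reverse.reverse ++
        update (update s 0 []) (N + 1) ((enc (y a)).reverse ++ s (N + 1)) 1))
    (by simp [hsN, N])
  obtain ⟨n, hn, s', hs', hout⟩ := h a
  have hs'' := hs'.frame (N := N) (by omega) (update s N [])
  have r₄ : Runs c _ (T a) _ := ⟨n, hn, hs''⟩
  have hlen (i : ℕ) (hi : i ≤ N - 1) : (Store.mix N s' (update s N []) i).length ≤ L a := by
    rw [Store.mix_apply (by omega)]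
    refine (hs'.length_le i).trans ?_
    simp only [inputStore, L, size]
    rcases i with - | - | i <;> simp <;> omega
  have r₅ := Runs.clearUpTo (N - 1) hlen
  refine (r₁.seq (r₂.seq ((r₃.congr ?_ le_rfl).seq (r₄.seq r₅)))).congr ?_ ?_
  · funext i
    simp only [Store.mix]
    split_ifs with hi
    · rcases i with - | - | i
      · simp [N, inputStore]
      · simp [N, inputStore, h1]
      · have h2 := hN (i + 2) (by omega) (by omega) (by omega)
        have h3 : i + 1 + 1 ≠ N := by omega
        have h4 : i + 1 ≠ N := by omega
        simp [inputStore, h2, h3, h4]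
    · have h0 : i ≠ 0 := by omega
      have h1 : i ≠ 1 := by omega
      simp only [update_apply, if_neg h0, if_neg h1]
      split_ifs <;> simp_all
  · funext i
    simp only [Store.mix]
    rcases eq_or_ne i 0 with rfl | hi
    · simp [hout, N]
    · rw [update_of_ne hi]
      split_ifs with h1 h2
      · rw [update_of_ne (by omega)]; exact (hN i (by omega) (by omega) (by omega)).symm
      · omega
      · rfl
  · have e : (2 * L a + 1) * (N - 1) ≤ (2 * L a + 1) * N := Nat.mul_le_mul_left _ (by omega)
    simp only [List.length_reverse, L, size] at e ⊢
    omega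

end PolyTime

open PolyTime

/-- The two raw inputs are combined into the code of one pair, on which the program for `d` runs. -/
theorem polyTimeDecidable_of_polyTime {R : List Bool → List Bool → Prop}
    {d : List Bool × List Bool → Bool} (hd : PolyTime d)
    (hR : ∀ x y, d (x, y) = true ↔ R x y) : PolyTimeDecidable R := by
  have hd' : PolyTime (fun p : RawString × RawString => d (p.1.bits, p.2.bits)) := by fun_prop
  obtain ⟨c, N, T, ⟨q, hq⟩, h⟩ := hd'
  -- The moves and the pairing take at most `13 * x.length + 8 * y.length + 5` steps, generously
  -- bounded with the factor `30`; the argument `2 * X + 1` of `q` bounds the size of the pair.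
  suffices H : ∀ x y, OutputsWithin (.seq (Prog.moveRev 0 2) (.seq (Prog.moveRev 1 3)
      (.seq (Prog.moveRev 3 0) (.seq (Prog.pairUp 2) c)))) [x, y] ((Polynomial.C 30 *
        Polynomial.X + Polynomial.C 5 + q.comp (Polynomial.C 2 * Polynomial.X +
          Polynomial.C 1)).eval (x.length + y.length)) [d (x, y)] by
    exact ⟨_, _, fun x y => ⟨fun hxy => by simpa only [(hR x y).2 hxy] using H x y, fun hxy => by
      simpa only [Bool.eq_false_iff.2 fun hd => hxy ((hR x y).1 hd)] using H x y⟩⟩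
  intro x y
  set s := inputStore [x, y] with hs
  have hs2 (i : ℕ) : s (i + 2) = [] := by simp [hs, inputStore]
  have r₁ := Runs.moveRev (r := 0) (d := 2) (by omega) (s := s) (u := x) rfl
  have r₂ := Runs.moveRev (r := 1) (d := 3) (by omega)
    (s := update (update s 0 []) 2 (x.reverse ++ s 2)) (u := y) rfl
  have r₃ := Runs.moveRev (r := 3) (d := 0) (by omega) (s := update (update (update (update s 0 [])
    2 (x.reverse ++ s 2)) 1 []) 3 (y.reverse ++ update (update s 0 []) 2 (x.reverse ++ s 2) 3))
    (u := y.reverse) (by simp [hs2 1])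
  have e₃ : update (update (update (update (update (update s 0 []) 2 (x.reverse ++ s 2)) 1 []) 3
      (y.reverse ++ update (update s 0 []) 2 (x.reverse ++ s 2) 3)) 3 []) 0 (y.reverse.reverse ++
      update (update (update (update s 0 []) 2 (x.reverse ++ s 2)) 1 []) 3
        (y.reverse ++ update (update s 0 []) 2 (x.reverse ++ s 2) 3) 0)
      = update (update (fun _ => []) 0 y) 2 x.reverse := by
    have hs' (i : ℕ) (h0 : i ≠ 0) (h1 : i ≠ 1) : s i = [] := by
      obtain ⟨j, rfl⟩ : ∃ j, i = j + 2 := ⟨i - 2, by omega⟩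
      exact hs2 j
    have h2 := hs' 2
    have h3 := hs' 3
    funext i
    simp only [update_apply]
    split_ifs <;> simp_all
  rw [e₃] at r₃
  have r₄ := Runs.pairUp (N := 2) (by omega) (s := update (update (fun _ => []) 0 y) 2 x.reverse)
    (u := x) (by simp)
  have r₅ := h (⟨x⟩, ⟨y⟩) (update (fun _ => []) 0 (pairCode x y)) (by simp [enc]) fun i hi _ => by
    simp [hi.ne']
  have e₄ : update (update (update (update (fun _ => []) 0 y) 2 x.reverse) 2 []) 0 (pairCode x
      (update (update (fun _ => []) 0 y) 2 x.reverse 0)) = update (fun _ => []) 0 (pairCode x y) := by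
    funext i
    simp only [update_apply]
    split_ifs <;> simp_all
  rw [e₄] at r₄
  obtain ⟨n, hn, hr⟩ := r₁.seq (r₂.seq (r₃.seq (r₄.seq r₅)))
  refine ⟨n, hn.trans ?_, _, hr, by simp [enc]⟩
  have hT := (hq (⟨x⟩, ⟨y⟩)).trans (eval_mono q (show size (RawString.mk x, RawString.mk y) ≤
    2 * (x.length + y.length) + 1 by rw [size_pair]; simp only [size, enc]; omega))
  simp only [List.length_reverse, Polynomial.eval_add, Polynomial.eval_mul, Polynomial.eval_C,
    Polynomial.eval_X, Polynomial.eval_comp]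
  omega

/-- Conversely, a decision program becomes available to the calculus of `PolyTime` functions, by
passing it both arguments as raw strings. -/
theorem PolyTimeDecidable.exists_polyTime {R : List Bool → List Bool → Prop}
    (hR : PolyTimeDecidable R) : ∃ d : List Bool × List Bool → Bool,
    PolyTime d ∧ ∀ x y, d (x, y) = true ↔ R x y := by
  classical
  obtain ⟨c, q, h⟩ := hR
  refine ⟨fun p => decide (R p.1 p.2), ?_, by simp⟩
  refine of_program (x := fun p => RawString.mk p.1) (y := fun p => RawString.mk p.2) (by fun_prop)
    (by fun_prop) c (T := fun p => q.eval (p.1.length + p.2.length)) ?_ fun p => ?_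
  · refine (PolyBounded.mono PolyBounded.size' fun p => ?_ : PolyBounded _).eval q
    have := length_le_size p.1
    have := length_le_size p.2
    rw [show size p = _ from size_pair p.1 p.2]
    omega
  · by_cases hp : R p.1 p.2
    · simpa [hp, enc] using (h p.1 p.2).1 hp
    · simpa [hp, enc] using (h p.1 p.2).2 hp

end

section

variable {α β γ δ σ : Type} [Code α] [Code β] [Code γ] [Code δ] [Code σ]

namespace PolyTime

/-! ### Folds over lists -/

/-- The accumulator may grow in each step only by an amount that depends on `a` alone, so its size
stays polynomial over the whole list. -/
theorem foldl [Inhabited β] {l : α → List β} {x : α → σ} {F : α → σ → β → σ} (hl : PolyTime l)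
    (hx : PolyTime x) (hF : PolyTime (fun p : α × σ × β => F p.1 p.2.1 p.2.2)) {K : α → ℕ}
    (hK : PolyBounded K) (hFK : ∀ a s, ∀ b ∈ l a, size (F a s b) ≤ size s + K a) :
    PolyTime (fun a => (l a).foldl (F a) (x a)) := by
  -- The step carries the parameter, the accumulator and the unread part of the list. It is the
  -- identity once the list is exhausted, so superfluous iterations do no harm.
  let step : α × σ × List β → α × σ × List β := fun p => bif p.2.2.isEmpty then p else
    (p.1, F p.1 p.2.1 (p.2.2.headD default), p.2.2.tail)
  have hstep : PolyTime step := by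
    have : PolyTime (fun p : α × σ × List β => F p.1 p.2.1 (p.2.2.headD default)) :=
      hF.comp (f := fun p : α × σ × List β => (p.1, p.2.1, p.2.2.headD default)) (by fun_prop)
    fun_prop
  have hi : ∀ a i, step^[i] (a, x a, l a) = (a, ((l a).take i).foldl (F a) (x a), (l a).drop i) := by
    intro a i
    induction i with
    | zero => simp
    | succ i ih =>
      rw [iterate_succ_apply', ih]
      rcases Nat.lt_or_ge i (l a).length with hil | hil
      · have hne : ((l a).drop i).isEmpty = false := by simp [hil]
        simp only [step, hne, cond_false, List.tail_drop, Prod.mk.injEq, true_and, and_true]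
        rw [List.take_add_one, List.foldl_append]
        simp [List.getElem?_eq_getElem hil, List.headD_eq_head?_getD, List.head?_drop]
      · have hne : ((l a).drop i).isEmpty = true := by simp [hil]
        simp only [step, hne, cond_true]
        rw [List.take_of_length_le hil, List.take_of_length_le (by omega),
          List.drop_eq_nil_of_le hil, List.drop_eq_nil_of_le (by omega)]
  have hbound : ∀ a i, size (((l a).take i).foldl (F a) (x a)) ≤ size (x a) + size (l a) * K a := by
    intro a i
    have H : ∀ l' : List β, (∀ b ∈ l', b ∈ l a) → ∀ s,
        size (l'.foldl (F a) s) ≤ size s + l'.length * K a := by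
      intro l'
      induction l' with
      | nil => simp
      | cons b l' ih =>
        intro h s
        have h₁ := ih (fun b hb => h b (List.mem_cons_of_mem _ hb)) (F a s b)
        have h₂ := hFK a s b (h b (List.mem_cons_self))
        simp only [List.foldl_cons, List.length_cons, add_mul, one_mul]
        omega
    refine (H _ (fun b hb => List.mem_of_mem_take hb) _).trans ?_
    have := length_le_size (l a)
    gcongr
    rw [List.length_take]
    omega
  have hbl := hl.polyBounded
  -- The size of the list serves as an upper bound for its length, whose computability is itself
  -- derived from folds.
  have h := iterate (n := fun a => size (l a)) (x := fun a => (a, x a, l a)) (F := step)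
    (by fun_prop) (by fun_prop) hstep
    (B := fun a => 2 * size a + 1 + (2 * (size (x a) + size (l a) * K a) + 1 + size (l a)))
    ((((PolyBounded.const 2).mul .size').add (.const 1)).add
      ((((PolyBounded.const 2).mul (hx.polyBounded.add (hbl.mul hK))).add (.const 1)).add hbl))
    fun a i _ => by
      rw [hi, size_pair, size_pair]
      have h₁ := hbound a i
      have h₂ := size_le_of_suffix (List.drop_suffix i (l a))
      omega
  have h' := fst (snd h)
  simp only [hi] at h'
  convert h' using 2 with a
  rw [List.take_of_length_le (length_le_size _)]

@[fun_prop]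
theorem reverse [Inhabited β] {l : α → List β} (hl : PolyTime l) :
    PolyTime (fun a => (l a).reverse) := by
  have := foldl (x := fun _ => ([] : List β)) (F := fun _ s b => b :: s) hl (by fun_prop)
    (by fun_prop) (K := fun a => 2 * size (l a) + 1)
    (((PolyBounded.const 2).mul hl.polyBounded).add (.const 1)) fun a s b hb => by
      rw [size_cons]
      have := size_le_of_mem hb
      omega
  simpa only [List.foldl_flip_cons_eq_append, List.append_nil, List.map_id'] using this

theorem foldr [Inhabited β] {l : α → List β} {x : α → σ} {F : α → β → σ → σ} (hl : PolyTime l)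
    (hx : PolyTime x) (hF : PolyTime (fun p : α × σ × β => F p.1 p.2.2 p.2.1)) {K : α → ℕ}
    (hK : PolyBounded K) (hFK : ∀ a s, ∀ b ∈ l a, size (F a b s) ≤ size s + K a) :
    PolyTime (fun a => (l a).foldr (F a) (x a)) := by
  have := foldl (F := fun a s b => F a b s) hl.reverse hx hF hK fun a s b hb =>
    hFK a s b (List.mem_reverse.1 hb)
  simpa only [List.foldl_reverse] using this

/-- No entry is larger than the list, so the values at all entries have a common polynomial bound in
terms of `a`. -/
theorem polyBounded_of_mem {l : α → List β} (hl : PolyTime l) {F : α → β → γ}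
    (hF : PolyTime (fun p : α × β => F p.1 p.2)) :
    ∃ K : α → ℕ, PolyBounded K ∧ ∀ a, ∀ b ∈ l a, size (F a b) ≤ K a := by
  obtain ⟨q, hq⟩ := hF.polyBounded
  refine ⟨_, (((PolyBounded.const 2).mul .size').add (.const 1)).add hl.polyBounded |>.eval q,
    fun a b hb => (hq (a, b)).trans (eval_mono q ?_)⟩
  rw [size_pair]
  have := size_le_of_mem hb
  omega

@[fun_prop]
theorem map [Inhabited β] {l : α → List β} {F : α → β → γ} (hl : PolyTime l)
    (hF : PolyTime (fun p : α × β => F p.1 p.2)) : PolyTime (fun a => (l a).map (F a)) := by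
  obtain ⟨K, hK, hFK⟩ := polyBounded_of_mem hl hF
  have hF' : PolyTime (fun p : α × List γ × β => F p.1 p.2.2) :=
    hF.comp (f := fun p : α × List γ × β => (p.1, p.2.2)) (by fun_prop)
  have := foldr (x := fun _ => ([] : List γ)) (F := fun a b s => F a b :: s) hl (by fun_prop)
    (by fun_prop) (((PolyBounded.const 2).mul hK).add (.const 1)) fun a s b hb => by
      rw [size_cons]
      have := hFK a b hb
      omega
  convert this using 2 with a
  rw [List.map_eq_foldr]

@[fun_prop]
theorem append [Inhabited β] {l l' : α → List β} (hl : PolyTime l) (hl' : PolyTime l') :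
    PolyTime (fun a => l a ++ l' a) := by
  have := foldr (F := fun _ b s => b :: s) hl hl'
    (by fun_prop) (K := fun a => 2 * size (l a) + 1)
    (((PolyBounded.const 2).mul hl.polyBounded).add (.const 1)) fun a s b hb => by
      rw [size_cons]
      have := size_le_of_mem hb
      omega
  simpa only [List.foldr_cons_eq_append', List.foldr_cons_eq_append, List.map_id'] using this

@[fun_prop]
theorem flatMap [Inhabited β] [Inhabited γ] {l : α → List β} {F : α → β → List γ} (hl : PolyTime l)
    (hF : PolyTime (fun p : α × β => F p.1 p.2)) : PolyTime (fun a => (l a).flatMap (F a)) := by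
  obtain ⟨K, hK, hFK⟩ := polyBounded_of_mem hl hF
  have hF' : PolyTime (fun p : α × List γ × β => F p.1 p.2.2) :=
    hF.comp (f := fun p : α × List γ × β => (p.1, p.2.2)) (by fun_prop)
  have := foldr (x := fun _ => ([] : List γ)) (F := fun a b s => F a b ++ s) hl (by fun_prop)
    (by fun_prop) hK fun a s b hb => by
      rw [size_append]
      have := hFK a b hb
      omega
  convert this using 2 with a
  induction l a with
  | nil => rfl
  | cons b l ih => simp [ih]

@[fun_prop]
theorem not {p : α → Bool} (hp : PolyTime p) : PolyTime (fun a => !(p a)) := by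
  have : PolyTime (fun a => bif p a then false else true) := by fun_prop
  simpa using this

@[fun_prop]
theorem and {p p' : α → Bool} (hp : PolyTime p) (hp' : PolyTime p') :
    PolyTime (fun a => p a && p' a) := by
  have : PolyTime (fun a => bif p a then p' a else false) := by fun_prop
  simpa using this

@[fun_prop]
theorem or {p p' : α → Bool} (hp : PolyTime p) (hp' : PolyTime p') :
    PolyTime (fun a => p a || p' a) := by
  have : PolyTime (fun a => bif p a then true else p' a) := by fun_prop
  simpa using this

@[fun_prop]
theorem all [Inhabited β] {l : α → List β} {F : α → β → Bool} (hl : PolyTime l)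
    (hF : PolyTime (fun p : α × β => F p.1 p.2)) : PolyTime (fun a => (l a).all (F a)) := by
  have hF' : PolyTime (fun p : α × Bool × β => F p.1 p.2.2) :=
    hF.comp (f := fun p : α × Bool × β => (p.1, p.2.2)) (by fun_prop)
  have := foldr (x := fun _ => true) (F := fun a b s => F a b && s) hl (by fun_prop)
    (by fun_prop) (.const 0) fun a s b hb => by simp [size_bool]
  convert this using 2 with a
  induction l a with
  | nil => rfl
  | cons b l ih => simp [ih]

@[fun_prop]
theorem any [Inhabited β] {l : α → List β} {F : α → β → Bool} (hl : PolyTime l)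
    (hF : PolyTime (fun p : α × β => F p.1 p.2)) : PolyTime (fun a => (l a).any (F a)) := by
  have : PolyTime (fun a => !((l a).all fun b => !(F a b))) := by fun_prop
  convert this using 2 with a
  simp [List.not_all_eq_any_not]

@[fun_prop]
theorem length [Inhabited β] {l : α → List β} (hl : PolyTime l) :
    PolyTime (fun a => (l a).length) := by
  have := foldr (x := fun _ => 0) (F := fun _ _ s => s + 1) hl (by fun_prop)
    (by fun_prop) (.const 1) fun a s b hb => by simp [size_nat]
  convert this using 2 with a
  induction l a with
  | nil => rfl
  | cons b l ih => rw [List.length_cons, ih]; rfl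

/-! ### Arithmetic -/

@[fun_prop]
theorem add {m n : α → ℕ} (hm : PolyTime m) (hn : PolyTime n) : PolyTime (fun a => m a + n a) := by
  have := length ((replicate_unit.comp hm).append (replicate_unit.comp hn))
  convert this using 2 with a
  rw [List.length_append, List.length_replicate, List.length_replicate]

theorem tail_iterate {ε : Type} (n : ℕ) (l : List ε) : List.tail^[n] l = l.drop n := by
  induction n with
  | zero => rfl
  | succ n ih => rw [iterate_succ_apply', ih, List.tail_drop]

@[fun_prop]
theorem drop [Inhabited β] {l : α → List β} {n : α → ℕ} (hl : PolyTime l) (hn : PolyTime n) :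
    PolyTime (fun a => (l a).drop (n a)) := by
  have := iterate hn hl (F := List.tail) (by fun_prop) hl.polyBounded fun a i _ => by
    rw [tail_iterate]
    exact size_le_of_suffix (List.drop_suffix _ _)
  simpa only [tail_iterate] using this

@[fun_prop]
theorem getD [Inhabited β] {l : α → List β} {n : α → ℕ} (hl : PolyTime l) (hn : PolyTime n)
    (d : β) : PolyTime (fun a => (l a).getD (n a) d) := by
  have : PolyTime (fun a => ((l a).drop (n a)).headD d) := by fun_prop
  simpa only [List.headD_eq_head?_getD, List.head?_drop, ← List.getD_eq_getElem?_getD] using this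

@[fun_prop]
theorem sub {m n : α → ℕ} (hm : PolyTime m) (hn : PolyTime n) : PolyTime (fun a => m a - n a) := by
  have := length ((replicate_unit.comp hm).drop hn)
  simpa using this

@[fun_prop]
theorem mul {m n : α → ℕ} (hm : PolyTime m) (hn : PolyTime n) : PolyTime (fun a => m a * n a) := by
  have : PolyTime (fun a => ((List.replicate (m a) ()).flatMap
      fun _ => List.replicate (n a) ()).length) := by
    have h₁ := replicate_unit.comp hm
    have h₂ := replicate_unit.comp (hn.comp (f := fun p : α × Unit => p.1) (by fun_prop))
    fun_prop
  simpa using this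

@[fun_prop]
theorem ble {m n : α → ℕ} (hm : PolyTime m) (hn : PolyTime n) :
    PolyTime (fun a => Nat.ble (m a) (n a)) := by
  have : PolyTime (fun a => m a - n a == 0) := beq_zero (by fun_prop)
  convert this using 2 with a
  rw [Bool.eq_iff_iff]
  simp [Nat.sub_eq_zero_iff_le]

@[fun_prop]
theorem beq {m n : α → ℕ} (hm : PolyTime m) (hn : PolyTime n) :
    PolyTime (fun a => Nat.beq (m a) (n a)) := by
  have : PolyTime (fun a => Nat.ble (m a) (n a) && Nat.ble (n a) (m a)) := by fun_prop
  convert this using 2 with a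
  rw [Bool.eq_iff_iff]
  simp only [Nat.beq_eq, Bool.and_eq_true, Nat.ble_eq]
  exact le_antisymm_iff

@[fun_prop]
theorem range {n : α → ℕ} (hn : PolyTime n) : PolyTime (fun a => List.range (n a)) := by
  suffices H : PolyTime (fun n : ℕ => List.range n) from H.comp hn
  -- The first component is the next number; the list is built in reverse order.
  let step : ℕ × List ℕ → ℕ × List ℕ := fun p => (p.1 + 1, p.1 :: p.2)
  have hi : ∀ i, step^[i] (0, []) = (i, (List.range i).reverse) := by
    intro i
    induction i with
    | zero => rfl
    | succ i ih => rw [iterate_succ_apply', ih]; simp [step, List.range_succ]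
  have hs : ∀ i, size (List.range i) ≤ i * (2 * i + 1) := by
    intro i
    induction i with
    | zero => rfl
    | succ i ih =>
      rw [List.range_succ, size_append, size_cons, size_nil, size_nat]
      nlinarith
  have h := iterate (n := fun n : ℕ => n) (x := fun _ => (0, [])) (F := step) (by fun_prop)
    (by fun_prop) (by fun_prop) (B := fun n => 2 * size n + 1 + size n * (2 * size n + 1)) ?_
    fun n i hin => ?_
  · have h' := reverse (snd h)
    simpa only [hi, List.reverse_reverse] using h'
  · have h₂ : PolyBounded (fun n : ℕ => 2 * size n + 1) :=
      ((PolyBounded.const 2).mul .size').add (.const 1)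
    exact h₂.add (PolyBounded.size'.mul h₂)
  · rw [hi, size_pair, size_reverse, size_nat, size_nat]
    have h₁ := hs i
    have h₂ : i * (2 * i + 1) ≤ n * (2 * n + 1) := by gcongr
    omega

end PolyTime

end

/-! ### Graphs as assignments of the Johnson group -/

section Johnson

variable {n k t : ℕ}

/-- Those vertices of `Γ` that `e` maps into `S` are the two ends of an edge. -/
def MeetsInEdge (Γ : SimpleGraph (Fin n)) (e : Fin n → Fin k) (S : Finset (Fin k)) : Prop :=
  ∃ i j, Γ.Adj i j ∧ ∀ l, e l ∈ S ↔ l = i ∨ l = j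

open Classical in
/-- The hypergraph of the `t`-sets that meet the embedded graph in an edge. -/
noncomputable def hypergraph (t : ℕ) (Γ : SimpleGraph (Fin n)) (e : Fin n → Fin k) :
    Set.powersetCard (Fin k) t → Bool :=
  fun S => decide (MeetsInEdge Γ e S)

theorem hypergraph_eq_iff {n' : ℕ} {Γ : SimpleGraph (Fin n)} {e : Fin n → Fin k}
    {Γ' : SimpleGraph (Fin n')} {e' : Fin n' → Fin k} {S S' : Set.powersetCard (Fin k) t} :
    hypergraph t Γ e S = hypergraph t Γ' e' S' ↔ (MeetsInEdge Γ e S ↔ MeetsInEdge Γ' e' S') := by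
  simp [hypergraph]

/-- Relabelling the vertices of the graph and of the embedding alike leaves the embedded copy in
place. This allows embeddings to be sorted. -/
theorem hypergraph_comap (Γ : SimpleGraph (Fin n)) (e : Fin n → Fin k) (σ : Equiv.Perm (Fin n)) :
    hypergraph t (Γ.comap σ) (e ∘ σ) = hypergraph t Γ e := by
  funext S
  rw [hypergraph_eq_iff]
  constructor
  · rintro ⟨i, j, h, hS⟩
    refine ⟨σ i, σ j, h, fun l => ?_⟩
    have := hS (σ.symm l)
    simpa [Equiv.symm_apply_eq] using this
  · rintro ⟨i, j, h, hS⟩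
    refine ⟨σ.symm i, σ.symm j, by simpa using h, fun l => ?_⟩
    simpa [Equiv.eq_symm_apply] using hS (σ l)

theorem hypergraph_smul (Γ : SimpleGraph (Fin n)) (e : Fin n → Fin k) (g : Equiv.Perm (Fin k))
    (S : Set.powersetCard (Fin k) t) :
    hypergraph t Γ (g ∘ e) (g • S) = hypergraph t Γ e S := by
  rw [hypergraph_eq_iff]
  have h (l : Fin n) : (g ∘ e) l ∈ ((g • S : Set.powersetCard (Fin k) t) : Finset (Fin k)) ↔
      e l ∈ (S : Finset (Fin k)) := by
    rw [Set.powersetCard.coe_smul, comp_apply, ← Equiv.Perm.smul_def,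
      Finset.smul_mem_smul_finset_iff]
  simp only [MeetsInEdge, h]

/-! ### Orbits of hypergraphs and isomorphism of graphs -/

theorem mem_assignmentOrbit_johnsonGroup {τ τ' : Set.powersetCard (Fin k) t → Bool} :
    τ' ∈ assignmentOrbit (johnsonGroup k t) τ ↔
      ∃ g : Equiv.Perm (Fin k), ∀ S, τ' (g • S) = τ S := by
  simp [assignmentOrbit, johnsonGroup]

/-- A group element `g` turns `e` into `g ∘ e`. Sorting this embedding shifts the disorder from the
embedding to the graph. -/
theorem exists_of_mem_orbit {Γ : SimpleGraph (Fin n)} {e : Fin n → Fin k} (he : Injective e)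
    {τ : Set.powersetCard (Fin k) t → Bool}
    (hτ : τ ∈ assignmentOrbit (johnsonGroup k t) (hypergraph t Γ e)) :
    ∃ (Γ' : SimpleGraph (Fin n)) (e' : Fin n → Fin k), StrictMono e' ∧ Nonempty (Γ' ≃g Γ) ∧
      τ = hypergraph t Γ' e' := by
  obtain ⟨g, hg⟩ := mem_assignmentOrbit_johnsonGroup.1 hτ
  let σ := Tuple.sort (g ∘ e)
  refine ⟨Γ.comap σ, (g ∘ e) ∘ σ, (Tuple.monotone_sort (g ∘ e)).strictMono_of_injective
    ((g.injective.comp he).comp σ.injective), ⟨SimpleGraph.Iso.comap σ Γ⟩, ?_⟩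
  rw [hypergraph_comap]
  funext S
  rw [← smul_inv_smul g S, hg, hypergraph_smul]

/-- The symmetric group on `k` points is `n`-transitive, so some permutation carries `e ∘ φ.symm` to
`e'`. -/
theorem hypergraph_mem_orbit {Γ Γ' : SimpleGraph (Fin n)} (φ : Γ ≃g Γ') {e e' : Fin n → Fin k}
    (he : Injective e) (he' : Injective e') :
    hypergraph t Γ' e' ∈ assignmentOrbit (johnsonGroup k t) (hypergraph t Γ e) := by
  have := Equiv.Perm.isMultiplyPretransitive (Fin k) n
  obtain ⟨g, hg⟩ := MulAction.exists_smul_eq (Equiv.Perm (Fin k)) (⟨e ∘ φ.symm, he.comp φ.symm.injective⟩ : Fin n ↪ Fin k) ⟨e', he'⟩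
  have hg' : g ∘ (e ∘ φ.symm) = e' := funext fun i => DFunLike.congr_fun hg i
  refine mem_assignmentOrbit_johnsonGroup.2 ⟨g, fun S => ?_⟩
  rw [← hg', hypergraph_smul]
  have hΓ : Γ'.comap φ.toEquiv = Γ := by
    ext i j
    exact φ.map_adj_iff
  have := congrFun (hypergraph_comap (t := t) Γ' (e ∘ φ.symm) φ.toEquiv) S
  rw [← this, hΓ]
  congr 1
  funext i
  simp

/-! ### Recovering the graph from its hypergraph -/

/-- The pair `e u, e w` is padded with `t - 2` points off the image of `e`; `A` prescribes some of
these points and `B` confines them. -/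
theorem exists_powersetCard {e : Fin n → Fin k} (he : Injective e) (ht : 2 ≤ t) {u w : Fin n}
    (huw : u ≠ w) {A B : Finset (Fin k)} (hAB : A ⊆ B) (hB : ∀ i, e i ∉ B) (hA : A.card ≤ t - 2)
    (hB' : t - 2 ≤ B.card) :
    ∃ S : Set.powersetCard (Fin k) t, (∀ l, e l ∈ (S : Finset (Fin k)) ↔ l = u ∨ l = w) ∧
      A ⊆ S ∧ ∀ p ∈ (S : Finset (Fin k)), p ∈ B ∨ p ∈ Set.range e := by
  obtain ⟨C, hAC, hCB, hC⟩ := Finset.exists_subsuperset_card_eq hAB hA hB'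
  have hd : Disjoint ({e u, e w} : Finset (Fin k)) C := by
    rw [Finset.disjoint_left]
    intro p hp hpC
    rcases Finset.mem_insert.1 hp with rfl | hp
    · exact hB _ (hCB hpC)
    · rw [Finset.mem_singleton.1 hp] at hpC
      exact hB _ (hCB hpC)
  have hcard : ({e u, e w} ∪ C : Finset (Fin k)).card = t := by
    rw [Finset.card_union_of_disjoint hd, hC, Finset.card_pair (he.ne huw)]
    omega
  refine ⟨⟨{e u, e w} ∪ C, hcard⟩, fun l => ?_, hAC.trans Finset.subset_union_right, fun p hp => ?_⟩
  · have : e l ∉ C := fun h => hB l (hCB h)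
    simp [this, he.eq_iff]
  · rcases Finset.mem_union.1 hp with hp | hp
    · right
      rcases Finset.mem_insert.1 hp with rfl | hp
      · exact ⟨u, rfl⟩
      · exact ⟨w, (Finset.mem_singleton.1 hp).symm⟩
    · exact .inl (hCB hp)

theorem meetsInEdge_iff {Γ : SimpleGraph (Fin n)} {e : Fin n → Fin k} {S : Finset (Fin k)}
    {u w : Fin n} (huw : u ≠ w) (hS : ∀ l, e l ∈ S ↔ l = u ∨ l = w) :
    MeetsInEdge Γ e S ↔ Γ.Adj u w := by
  refine ⟨?_, fun h => ⟨u, w, h, hS⟩⟩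
  rintro ⟨i, j, h, hS'⟩
  have hij := h.ne
  have h' (l : Fin n) := (hS l).symm.trans (hS' l)
  have hu := (h' u).1 (.inl rfl)
  have hw := (h' w).1 (.inr rfl)
  rcases hu with rfl | rfl <;> rcases hw with rfl | rfl
  · exact absurd rfl huw
  · exact h
  · exact h.symm
  · exact absurd rfl huw

theorem card_compl_image {e : Fin n → Fin k} (he : Injective e) :
    (Finset.univ.image e)ᶜ.card = k - n := by
  rw [Finset.card_compl, Finset.card_image_of_injective _ he]
  simp

/-- With the embedding known, each pair of vertices is the trace of some `t`-set, at which the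
hypergraph tells whether the pair is an edge. -/
theorem eq_of_hypergraph_eq {Γ Γ' : SimpleGraph (Fin n)} {e : Fin n → Fin k} (he : Injective e)
    (ht : 2 ≤ t) (hk : t - 2 ≤ k - n) (h : hypergraph t Γ e = hypergraph t Γ' e) : Γ = Γ' := by
  ext u w
  rcases eq_or_ne u w with rfl | huw
  · simp
  obtain ⟨S, hS, -⟩ := exists_powersetCard he ht huw (A := ∅) (B := (Finset.univ.image e)ᶜ) (by simp)
    (by simp) (by simp) (by rwa [card_compl_image he])
  rw [← meetsInEdge_iff huw hS, ← meetsInEdge_iff huw hS]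
  exact hypergraph_eq_iff.1 (congrFun h S)

theorem hypergraph_swap {Γ : SimpleGraph (Fin n)} {e : Fin n → Fin k} {p q : Fin k}
    (hp : p ∉ Set.range e) (hq : q ∉ Set.range e) (S : Set.powersetCard (Fin k) t) :
    hypergraph t Γ e (Equiv.swap p q • S) = hypergraph t Γ e S := by
  have : Equiv.swap p q ∘ e = e := funext fun i =>
    Equiv.swap_apply_of_ne_of_ne (fun h => hp ⟨i, h⟩) (fun h => hq ⟨i, h⟩)
  conv_lhs => rw [← this]
  exact hypergraph_smul Γ e _ S

/-- Start from a `t`-set whose trace is an edge. If `c` is an end of that edge, the swap can remove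
it from the trace; otherwise the swap can add `c` as a third vertex. -/
theorem exists_hypergraph_swap_ne {Γ : SimpleGraph (Fin n)} (hΓ : Γ ≠ ⊥) {e : Fin n → Fin k}
    (he : Injective e) (ht : 3 ≤ t) (hk : n + t ≤ k) {p : Fin k} (hp : p ∉ Set.range e)
    (c : Fin n) : ∃ S, hypergraph t Γ e (Equiv.swap p (e c) • S) ≠ hypergraph t Γ e S := by
  obtain ⟨u, w, huw⟩ := SimpleGraph.ne_bot_iff_exists_adj.1 hΓ
  have hp' : p ∈ (Finset.univ.image e)ᶜ := by simpa using hp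
  -- The swap exchanges the roles of `p` and `e c` and affects no other vertex.
  have hmem (S : Set.powersetCard (Fin k) t) (l : Fin n) :
      e l ∈ ((Equiv.swap p (e c) • S : Set.powersetCard (Fin k) t) : Finset (Fin k)) ↔
      if l = c then p ∈ (S : Finset (Fin k)) else e l ∈ (S : Finset (Fin k)) := by
    rw [Set.powersetCard.coe_smul, ← Finset.inv_smul_mem_iff, Equiv.swap_inv, Equiv.Perm.smul_def]
    split_ifs with hl
    · rw [hl, Equiv.swap_apply_right]
    · rw [Equiv.swap_apply_of_ne_of_ne (fun h => hp ⟨l, h⟩) (he.ne hl)]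
  have hcard := card_compl_image he
  suffices H : ∃ S : Set.powersetCard (Fin k) t, MeetsInEdge Γ e S ∧
      ¬ MeetsInEdge Γ e (Equiv.swap p (e c) • S : Set.powersetCard (Fin k) t) by
    obtain ⟨S, h, h'⟩ := H
    exact ⟨S, fun hS => h' ((hypergraph_eq_iff.1 hS).2 h)⟩
  by_cases hc : c = u ∨ c = w
  -- The padding avoids `p`, so after the swap only one end of the edge is left.
  · obtain ⟨S, hS, -, hSB⟩ := exists_powersetCard he (by omega) huw.ne (A := ∅) (t := t)
      (B := (Finset.univ.image e)ᶜ.erase p) (by simp) (by simp) (by simp)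
      (by rw [Finset.card_erase_of_mem hp', hcard]; omega)
    refine ⟨S, ⟨u, w, huw, hS⟩, ?_⟩
    rintro ⟨i, j, hij, h⟩
    have hpS : p ∉ (S : Finset (Fin k)) := fun h => (hSB p h).elim (by simp) hp
    simp only [hmem, hpS, hS] at h
    have hi := (h i).2 (.inl rfl)
    have hj := (h j).2 (.inr rfl)
    have := hij.ne
    have := huw.ne
    grind
  -- The padding contains `p`, for which `3 ≤ t` leaves room, so after the swap the trace has three
  -- vertices.
  · obtain ⟨S, hS, hpS, -⟩ := exists_powersetCard he (by omega) huw.ne (A := {p}) (t := t)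
      (B := (Finset.univ.image e)ᶜ) (by simpa using hp) (by simp) (by simp; omega)
      (by rw [hcard]; omega)
    refine ⟨S, ⟨u, w, huw, hS⟩, ?_⟩
    rintro ⟨i, j, hij, h⟩
    have hpS : p ∈ (S : Finset (Fin k)) := hpS (by simp)
    simp only [hmem, hpS, hS] at h
    have hu := (h u)
    have hw := (h w)
    have hc' := (h c)
    have := huw.ne
    grind

/-- It suffices to recover the image, since an increasing embedding is determined by its image. For
`t ≥ 3` and a graph with edges, the points off the image are interchangeable, and none of them is
interchangeable with a point of the image. -/
theorem eq_of_hypergraph_eq_of_strictMono {Γ Γ' : SimpleGraph (Fin n)} (φ : Nonempty (Γ ≃g Γ'))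
    {e e' : Fin n → Fin k} (he : StrictMono e) (he' : StrictMono e')
    (hk : t = 2 ∧ k = n ∨ 3 ≤ t ∧ 2 * n < k ∧ n + t ≤ k)
    (h : hypergraph t Γ e = hypergraph t Γ' e') : Γ = Γ' := by
  -- For an edgeless graph the hypergraph is empty and does not reveal the image, but any isomorphic
  -- graph is edgeless too.
  by_cases hΓ : Γ = ⊥
  · obtain ⟨φ⟩ := φ
    subst hΓ
    ext u w
    have := φ.symm.map_adj_iff (v := u) (w := w)
    simpa using this
  suffices hr : Set.range e = Set.range e' by
    obtain rfl := (StrictMono.range_inj he he').1 hr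
    exact eq_of_hypergraph_eq he.injective (by omega) (by omega) h
  rcases hk with ⟨-, rfl⟩ | ⟨ht, hk, hk'⟩
  · rw [(Finite.injective_iff_surjective.1 he.injective).range_eq,
      (Finite.injective_iff_surjective.1 he'.injective).range_eq]
  have hc : (Finset.univ.image e').card = (Finset.univ.image e).card := by
    rw [Finset.card_image_of_injective _ he.injective, Finset.card_image_of_injective _ he'.injective]
  suffices hs : Finset.univ.image e' ⊆ Finset.univ.image e by
    have := Finset.eq_of_subset_of_card_le hs hc.ge
    have := congrArg (fun s : Finset (Fin k) => (s : Set (Fin k))) this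
    simpa using this.symm
  intro p hp'
  by_contra hp
  obtain ⟨q, hq⟩ : ((Finset.univ.image e) \ (Finset.univ.image e')).Nonempty := by
    rw [← Finset.card_pos, ← Finset.card_sdiff_comm hc, Finset.card_pos]
    exact ⟨p, Finset.mem_sdiff.2 ⟨hp', hp⟩⟩
  -- As `2 * n < k`, some point lies off both images.
  obtain ⟨r, hr⟩ : (Finset.univ.image e ∪ Finset.univ.image e')ᶜ.Nonempty := by
    rw [← Finset.card_pos, Finset.card_compl, Fintype.card_fin]
    have := Finset.card_union_le (Finset.univ.image e) (Finset.univ.image e')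
    rw [hc, Finset.card_image_of_injective _ he.injective, Finset.card_univ, Fintype.card_fin] at this
    omega
  simp only [Finset.mem_sdiff, Finset.mem_compl, Finset.mem_union, Finset.mem_image,
    Finset.mem_univ, true_and, not_or, ← Set.mem_range] at hp hp' hq hr
  obtain ⟨⟨c, rfl⟩, hq⟩ := hq
  obtain ⟨S, hS⟩ := exists_hypergraph_swap_ne hΓ he.injective ht hk' hp c
  have hpr : p ≠ r := fun h => hr.2 (h ▸ hp')
  have hpc : p ≠ e c := fun h => hp ⟨c, h.symm⟩
  -- Both `p` and `r` lie off the image of `e`, and both `r` and `e c` off the image of `e'`. So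
  -- every factor preserves the common hypergraph, and hence so does the forbidden swap.
  have hs : Equiv.swap p (e c) = Equiv.swap p r * Equiv.swap r (e c) * Equiv.swap p r := by
    have := Equiv.swap_mul_swap_mul_swap (x := e c) (y := r) (z := p)
      (fun h => hr.1 ⟨c, h⟩) hpc.symm
    grind [Equiv.swap_comm]
  apply hS
  rw [hs, mul_smul, mul_smul, hypergraph_swap hp hr.1, h, hypergraph_swap hr.2 hq, ← h,
    hypergraph_swap hp hr.1]

/-- A complete symmetry breaking circuit for the Johnson group selects one graph from every
isomorphism class. -/
theorem existsUnique_satisfiableAt {A : Type} {ψ : Circuit (Set.powersetCard (Fin k) t ⊕ A)}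
    (hψ : IsCompleteSymmetryBreaking (johnsonGroup k t) ψ)
    (hk : t = 2 ∧ k = n ∨ 3 ≤ t ∧ 2 * n < k ∧ n + t ≤ k) (Γ : SimpleGraph (Fin n)) :
    ∃! Γ' : SimpleGraph (Fin n), Nonempty (Γ' ≃g Γ) ∧
      ∃ e : Fin n → Fin k, StrictMono e ∧ ψ.SatisfiableAt (hypergraph t Γ' e) := by
  have hnk : n ≤ k := by omega
  have he₀ : Injective (Fin.castLE hnk) := Fin.castLE_injective hnk
  obtain ⟨τ, hτ, hsat, huniq⟩ := hψ (hypergraph t Γ (Fin.castLE hnk))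
  -- Every hypergraph of a graph isomorphic to `Γ` lies in the orbit in which `τ` is the only
  -- accepted member.
  have key {Γ' : SimpleGraph (Fin n)} (hΓ' : Nonempty (Γ' ≃g Γ)) {e : Fin n → Fin k}
      (he : StrictMono e) (h : ψ.SatisfiableAt (hypergraph t Γ' e)) : hypergraph t Γ' e = τ := by
    by_contra hne
    obtain ⟨φ⟩ := hΓ'
    exact huniq _ (hypergraph_mem_orbit φ.symm he₀ he.injective) hne h
  obtain ⟨Γ', e', he', hΓ', rfl⟩ := exists_of_mem_orbit he₀ hτ
  refine ⟨Γ', ⟨hΓ', e', he', hsat⟩, ?_⟩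
  rintro Γ'' ⟨hΓ'', e'', he'', hsat''⟩
  obtain ⟨φ⟩ := hΓ'
  obtain ⟨φ'⟩ := hΓ''
  exact eq_of_hypergraph_eq_of_strictMono ⟨φ'.trans φ.symm⟩ he'' he' hk
    (key ⟨φ'⟩ he'' hsat'')

end Johnson

/-! ### Reading numbers from strings -/

/-- The number of leading ones. -/
def unary (l : List Bool) : ℕ := l.foldr (fun b n => bif b then n + 1 else 0) 0

/-- The string after its first zero. -/
def skip (l : List Bool) : List Bool := l.drop (unary l + 1)

/-- The string after its `i`-th zero. -/
def skips (l : List Bool) (i : ℕ) : List Bool := skip^[i] l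

theorem unary_encodeNat (n : ℕ) (l : List Bool) : unary (encodeNat n ++ l) = n := by
  induction n with
  | zero => rfl
  | succ n ih =>
    have : unary (encodeNat (n + 1) ++ l) = unary (encodeNat n ++ l) + 1 := rfl
    rw [this, ih]

theorem skip_encodeNat (n : ℕ) (l : List Bool) : skip (encodeNat n ++ l) = l := by
  rw [skip, unary_encodeNat, List.drop_append_of_le_length (by simp [encodeNat]),
    List.drop_eq_nil_of_le (by simp [encodeNat]), List.nil_append]

theorem skips_zero (l : List Bool) : skips l 0 = l := rfl

theorem skips_succ (l : List Bool) (i : ℕ) : skips l (i + 1) = skip (skips l i) :=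
  iterate_succ_apply' skip i l

theorem skips_add (l : List Bool) (i j : ℕ) : skips l (i + j) = skips (skips l i) j := by
  rw [add_comm]
  exact iterate_add_apply skip j i l

theorem skips_suffix (l : List Bool) (i : ℕ) : skips l i <:+ l := by
  induction i with
  | zero => exact List.suffix_rfl
  | succ i ih => rw [skips_succ]; exact (List.drop_suffix _ _).trans ih

theorem skips_flatMap (ns : List ℕ) (l : List Bool) :
    skips (ns.flatMap encodeNat ++ l) ns.length = l := by
  induction ns with
  | nil => rfl
  | cons n ns ih =>
    rw [List.length_cons, add_comm, skips_add, skips_succ, skips_zero, List.flatMap_cons,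
      List.append_assoc, skip_encodeNat, ih]

theorem skips_flatMap_drop (ns : List ℕ) (l : List Bool) {i : ℕ} (hi : i ≤ ns.length) :
    skips (ns.flatMap encodeNat ++ l) i = (ns.drop i).flatMap encodeNat ++ l := by
  conv_lhs => rw [← List.take_append_drop i ns, List.flatMap_append, List.append_assoc]
  have := skips_flatMap (ns.take i) ((ns.drop i).flatMap encodeNat ++ l)
  rwa [List.length_take, min_eq_left hi] at this

theorem unary_skips_flatMap (ns : List ℕ) (l : List Bool) {i : ℕ} (hi : i < ns.length) :
    unary (skips (ns.flatMap encodeNat ++ l) i) = ns[i] := by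
  rw [skips_flatMap_drop ns l hi.le, List.drop_eq_getElem_cons hi, List.flatMap_cons,
    List.append_assoc, unary_encodeNat]

theorem length_flatMap_encodeNat_le {n k : ℕ} (e : Fin n → Fin k) :
    ((List.ofFn fun i => (e i : ℕ)).flatMap encodeNat).length ≤ n * (k + 1) := by
  rw [List.length_flatMap]
  have := List.sum_le_card_nsmul ((List.ofFn fun i => (e i : ℕ)).map fun v =>
    (encodeNat v).length) (k + 1) fun v hv => by
      simp only [List.map_ofFn, List.mem_ofFn] at hv
      obtain ⟨i, rfl⟩ := hv
      simp [encodeNat, (e i).2.le]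
  simpa using this

/-- The hypothesis says that the leading ones are not the whole string, so a zero follows them. -/
theorem eq_encodeNat_append {l : List Bool} (h : unary l < l.length) :
    l = encodeNat (unary l) ++ skip l := by
  induction l with
  | nil => simp at h
  | cons b l ih =>
    cases b
    · rfl
    · have e : unary (true :: l) = unary l + 1 := rfl
      rw [e, List.length_cons] at h
      have := ih (by omega)
      rw [skip, e, List.drop_succ_cons, ← skip]
      conv_lhs => rw [this]
      rfl

namespace PolyTime

variable {α : Type} [Code α]

@[fun_prop]
theorem unary {l : α → List Bool} (hl : PolyTime l) : PolyTime (fun a => unary (l a)) := by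
  have := foldr (x := fun _ => 0) (F := fun _ b n => bif b then n + 1 else 0) hl (by fun_prop)
    (by fun_prop) (.const 1) fun a s b _ => by
      cases b <;> simp [size_nat]
  exact this

@[fun_prop]
theorem skip {l : α → List Bool} (hl : PolyTime l) : PolyTime (fun a => skip (l a)) := by
  unfold SymBreak.skip
  fun_prop

@[fun_prop]
theorem skips {l : α → List Bool} {i : α → ℕ} (hl : PolyTime l) (hi : PolyTime i) :
    PolyTime (fun a => skips (l a) (i a)) :=
  iterate hi hl (F := SymBreak.skip) (skip id) hl.polyBounded fun a i _ =>
    size_le_of_suffix (skips_suffix (l a) i)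

end PolyTime

/-! ### Codes of graphs -/

/-- The entry of an adjacency matrix that is written row by row. -/
def adjBit (n : ℕ) (M : List Bool) (i j : ℕ) : Bool := M.getD (i * n + j) false

/-- The adjacency matrix, row by row. -/
noncomputable def graphBits {n : ℕ} (Γ : SimpleGraph (Fin n)) : List Bool :=
  open Classical in
  (List.ofFn fun i : Fin n => List.ofFn fun j : Fin n => decide (Γ.Adj i j)).flatten

theorem encodeGraph_eq {n : ℕ} (Γ : SimpleGraph (Fin n)) :
    encodeGraph Γ = encodeNat n ++ graphBits Γ := rfl

open Classical in
theorem graphBits_eq_ofFn {n : ℕ} (Γ : SimpleGraph (Fin n)) : graphBits Γ =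
    List.ofFn fun q : Fin (n * n) => decide (Γ.Adj q.divNat q.modNat) := by
  rw [graphBits, List.ofFn_mul]
  congr 2
  funext i
  congr 1
  funext j
  have h₁ : (i * n + j : ℕ) / n = i := by
    rw [add_comm, Nat.add_mul_div_right _ _ i.pos, Nat.div_eq_of_lt j.2, zero_add]
  have h₂ : (i * n + j : ℕ) % n = j := by
    rw [Nat.mul_add_mod_self_right, Nat.mod_eq_of_lt j.2]
  congr 1
  simp only [Fin.divNat, Fin.modNat, h₁, h₂]

theorem length_graphBits {n : ℕ} (Γ : SimpleGraph (Fin n)) : (graphBits Γ).length = n * n := by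
  rw [graphBits_eq_ofFn, List.length_ofFn]

theorem length_encodeGraph {n : ℕ} (Γ : SimpleGraph (Fin n)) :
    (encodeGraph Γ).length = n + 1 + n * n := by
  simp only [encodeGraph_eq, encodeNat, length_graphBits, List.length_append,
    List.length_replicate, List.length_singleton]

theorem index_lt {n i j : ℕ} (hi : i < n) (hj : j < n) : i * n + j < n * n := by nlinarith

open Classical in
theorem adjBit_graphBits {n : ℕ} (Γ : SimpleGraph (Fin n)) (l : List Bool) (i j : Fin n) :
    adjBit n (graphBits Γ ++ l) i j = decide (Γ.Adj i j) := by
  have hlt := index_lt i.2 j.2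
  rw [adjBit, List.getD_append _ _ _ _ (by rwa [length_graphBits]), graphBits_eq_ofFn,
    List.getD_eq_getElem _ _ (by simpa using hlt), List.getElem_ofFn]
  have h₁ : (i * n + j : ℕ) / n = i := by
    rw [add_comm, Nat.add_mul_div_right _ _ i.pos, Nat.div_eq_of_lt j.2, zero_add]
  have h₂ : (i * n + j : ℕ) % n = j := by
    rw [Nat.mul_add_mod_self_right, Nat.mod_eq_of_lt j.2]
  simp only [Fin.divNat, Fin.modNat, h₁, h₂]

/-- The list of entries starts with the adjacency matrix of a graph. -/
def isGraphBits (n : ℕ) (M : List Bool) : Bool :=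
  Nat.ble (n * n) M.length && (List.range n).all fun i =>
    !(adjBit n M i i) && (List.range n).all fun j => !(adjBit n M i j) || adjBit n M j i

theorem isGraphBits_iff {n : ℕ} {M : List Bool} :
    isGraphBits n M = true ↔ ∃ (Γ : SimpleGraph (Fin n)) (l : List Bool), M = graphBits Γ ++ l := by
  constructor
  · intro h
    simp only [isGraphBits, Bool.and_eq_true, Nat.ble_eq, List.all_eq_true, List.mem_range,
      Bool.not_eq_true', Bool.or_eq_true] at h
    obtain ⟨hlen, h⟩ := h
    let Γ : SimpleGraph (Fin n) :=
      { Adj := fun i j => adjBit n M i j = true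
        symm := ⟨fun i j hij => ((h i i.2).2 j j.2).resolve_left (by simp [hij])⟩
        loopless := ⟨fun i hi => by simp [(h i i.2).1] at hi⟩ }
    refine ⟨Γ, M.drop (n * n), ?_⟩
    conv_lhs => rw [← List.take_append_drop (n * n) M]
    congr 1
    refine List.ext_getElem (by simp [hlen, length_graphBits]) fun q hq hq' => ?_
    rw [length_graphBits] at hq'
    have hn : 0 < n := by
      rcases Nat.eq_zero_or_pos n with rfl | hn
      · simp at hq'
      · exact hn
    have e := adjBit_graphBits Γ [] ⟨q / n, Nat.div_lt_of_lt_mul hq'⟩ ⟨q % n, Nat.mod_lt _ hn⟩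
    have eq : q / n * n + q % n = q := Nat.div_add_mod' q n
    simp only [adjBit, eq, List.append_nil, Γ, Bool.decide_eq_true] at e
    rw [List.getD_eq_getElem _ _ (by rwa [length_graphBits]),
      List.getD_eq_getElem _ _ (by omega)] at e
    rw [List.getElem_take]
    exact e.symm
  · rintro ⟨Γ, l, rfl⟩
    simp only [isGraphBits, Bool.and_eq_true, Nat.ble_eq, List.all_eq_true, List.mem_range,
      Bool.not_eq_true', Bool.or_eq_true, List.length_append, length_graphBits]
    refine ⟨by omega, fun i hi => ⟨?_, fun j hj => ?_⟩⟩
    · simp [adjBit_graphBits Γ l ⟨i, hi⟩ ⟨i, hi⟩]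
    · have h₁ := adjBit_graphBits Γ l ⟨i, hi⟩ ⟨j, hj⟩
      have h₂ := adjBit_graphBits Γ l ⟨j, hj⟩ ⟨i, hi⟩
      simp only at h₁ h₂
      simp only [h₁, h₂, decide_eq_false_iff_not, decide_eq_true_eq, Γ.adj_comm ⟨j, hj⟩]
      exact (em _).symm

/-- The string starts with the code of a graph. -/
def startsWithGraph (x : List Bool) : Bool :=
  Nat.ble (unary x + 1) x.length && isGraphBits (unary x) (skip x)

/-- The string after its initial graph. -/
def afterGraph (x : List Bool) : List Bool := (skip x).drop (unary x * unary x)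

theorem unary_encodeGraph {n : ℕ} (Γ : SimpleGraph (Fin n)) (l : List Bool) :
    unary (encodeGraph Γ ++ l) = n := by
  rw [encodeGraph_eq, List.append_assoc, unary_encodeNat]

theorem skip_encodeGraph {n : ℕ} (Γ : SimpleGraph (Fin n)) (l : List Bool) :
    skip (encodeGraph Γ ++ l) = graphBits Γ ++ l := by
  rw [encodeGraph_eq, List.append_assoc, skip_encodeNat]

theorem afterGraph_encodeGraph {n : ℕ} (Γ : SimpleGraph (Fin n)) (l : List Bool) :
    afterGraph (encodeGraph Γ ++ l) = l := by
  rw [afterGraph, skip_encodeGraph, unary_encodeGraph]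
  exact List.drop_left' (length_graphBits Γ)

theorem startsWithGraph_iff {x : List Bool} :
    startsWithGraph x = true ↔
      ∃ (n : ℕ) (Γ : SimpleGraph (Fin n)) (l : List Bool), x = encodeGraph Γ ++ l := by
  constructor
  · intro h
    simp only [startsWithGraph, Bool.and_eq_true, Nat.ble_eq, isGraphBits_iff] at h
    obtain ⟨h, Γ, l, hl⟩ := h
    refine ⟨_, Γ, l, ?_⟩
    rw [encodeGraph_eq, List.append_assoc, ← hl]
    exact eq_encodeNat_append h
  · rintro ⟨n, Γ, l, rfl⟩
    simp only [startsWithGraph, Bool.and_eq_true, Nat.ble_eq, isGraphBits_iff, unary_encodeGraph,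
      skip_encodeGraph, List.length_append, length_encodeGraph]
    exact ⟨by omega, Γ, l, rfl⟩

/-- The initial unary number fixes the length of the matrix, so a graph can be read off without
regard to what follows it. -/
theorem encodeGraph_append_inj {n : ℕ} {Γ Δ : SimpleGraph (Fin n)} {l l' : List Bool}
    (h : encodeGraph Γ ++ l = encodeGraph Δ ++ l') : Γ = Δ ∧ l = l' := by
  have hl := congrArg afterGraph h
  rw [afterGraph_encodeGraph, afterGraph_encodeGraph] at hl
  refine ⟨?_, hl⟩
  have hs := congrArg skip h
  rw [skip_encodeGraph, skip_encodeGraph] at hs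
  ext i j
  have h₁ := adjBit_graphBits Γ l i j
  rw [hs, adjBit_graphBits] at h₁
  exact (decide_eq_decide.1 h₁).symm

theorem unary_eq_of_encodeGraph_append {n m : ℕ} {Γ : SimpleGraph (Fin n)}
    {Δ : SimpleGraph (Fin m)} {l l' : List Bool} (h : encodeGraph Γ ++ l = encodeGraph Δ ++ l') :
    n = m := by
  have := congrArg unary h
  rwa [unary_encodeGraph, unary_encodeGraph] at this

namespace PolyTime

variable {α : Type} [Code α]

@[fun_prop]
theorem adjBit {n : α → ℕ} {M : α → List Bool} {i j : α → ℕ} (hn : PolyTime n) (hM : PolyTime M)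
    (hi : PolyTime i) (hj : PolyTime j) : PolyTime (fun a => adjBit (n a) (M a) (i a) (j a)) := by
  unfold SymBreak.adjBit
  fun_prop

@[fun_prop]
theorem startsWithGraph {x : α → List Bool} (hx : PolyTime x) :
    PolyTime (fun a => startsWithGraph (x a)) := by
  unfold SymBreak.startsWithGraph isGraphBits
  fun_prop

@[fun_prop]
theorem afterGraph {x : α → List Bool} (hx : PolyTime x) :
    PolyTime (fun a => afterGraph (x a)) := by
  unfold SymBreak.afterGraph
  fun_prop

end PolyTime

/-! ### Evaluation of circuits -/

/-- Read a gate from the first string and append its value to the second one; `S` gives the value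
of a variable that is coded by its `k`-bit characteristic vector, and `A` that of an additional
variable. -/
def gateStep (S : List Bool → Bool) (A : ℕ → Bool) (k : ℕ) (p : List Bool × List Bool) :
    List Bool × List Bool :=
  bif p.1.isEmpty then p else
  bif p.1.getD 0 false then
    (skip (skip (p.1.drop 2)), p.2 ++
      [bif p.1.getD 1 false then
        p.2.getD (unary (p.1.drop 2)) false || p.2.getD (unary (skip (p.1.drop 2))) false
      else p.2.getD (unary (p.1.drop 2)) false && p.2.getD (unary (skip (p.1.drop 2))) false])
  else bif p.1.getD 1 false then
    (skip (p.1.drop 2), p.2 ++ [!(p.2.getD (unary (p.1.drop 2)) false)])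
  else bif p.1.getD 2 false then
    (skip (p.1.drop 3), p.2 ++ [A (unary (p.1.drop 3))])
  else (p.1.drop (3 + k), p.2 ++ [S (p.1.drop 3)])

/-- The value of the circuit with the given code. -/
def evalCode (S : List Bool → Bool) (A : ℕ → Bool) (k : ℕ) (w : List Bool) : Bool :=
  ((gateStep S A k)^[w.length] (w, [])).2.reverse.headD false

theorem gateStep_fst_suffix (S : List Bool → Bool) (A : ℕ → Bool) (k : ℕ)
    (p : List Bool × List Bool) : (gateStep S A k p).1 <:+ p.1 := by
  have h (l : List Bool) : skip l <:+ l := List.drop_suffix _ _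
  unfold gateStep
  simp only [cond_eq_ite]
  split_ifs
  · exact List.suffix_rfl
  all_goals
    first
    | exact List.drop_suffix _ _
    | exact (h _).trans (List.drop_suffix _ _)
    | exact (h _).trans ((h _).trans (List.drop_suffix _ _))

theorem length_gateStep_snd (S : List Bool → Bool) (A : ℕ → Bool) (k : ℕ)
    (p : List Bool × List Bool) : (gateStep S A k p).2.length ≤ p.2.length + 1 := by
  unfold gateStep
  simp only [cond_eq_ite]
  split_ifs <;> simp

/-- Polynomial time is required on all strings, so these bounds must hold for an arbitrary `w`, not
only for codes of circuits. -/
theorem gateStep_iterate_bounds (S : List Bool → Bool) (A : ℕ → Bool) (k : ℕ) (w : List Bool)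
    (i : ℕ) : ((gateStep S A k)^[i] (w, [])).1 <:+ w ∧
      ((gateStep S A k)^[i] (w, [])).2.length ≤ i := by
  induction i with
  | zero => exact ⟨List.suffix_rfl, by simp⟩
  | succ i ih =>
    rw [iterate_succ_apply']
    exact ⟨(gateStep_fst_suffix _ _ _ _).trans ih.1,
      (length_gateStep_snd _ _ _ _).trans (by omega)⟩

namespace PolyTime

variable {α : Type} [Code α]

theorem evalCode {S : α → List Bool → Bool} {A : α → ℕ → Bool} {k : α → ℕ} {w : α → List Bool}
    (hS : PolyTime (fun p : α × List Bool => S p.1 p.2))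
    (hA : PolyTime (fun p : α × ℕ => A p.1 p.2)) (hk : PolyTime k) (hw : PolyTime w) :
    PolyTime (fun a => evalCode (S a) (A a) (k a) (w a)) := by
  -- The parameter `a` is carried along, since the values of the variables are computed from it.
  let step : α × List Bool × List Bool → α × List Bool × List Bool :=
    fun p => (p.1, gateStep (S p.1) (A p.1) (k p.1) p.2)
  have hS' : PolyTime (fun p : α × List Bool × List Bool => S p.1 (p.2.1.drop 3)) :=
    hS.comp (f := fun p : α × List Bool × List Bool => (p.1, p.2.1.drop 3)) (by fun_prop)
  have hA' : PolyTime (fun p : α × List Bool × List Bool => A p.1 (SymBreak.unary (p.2.1.drop 3))) :=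
    hA.comp (f := fun p : α × List Bool × List Bool => (p.1, SymBreak.unary (p.2.1.drop 3)))
      (by fun_prop)
  have hstep : PolyTime step := by
    unfold step gateStep
    fun_prop
  have hi : ∀ a i, step^[i] (a, w a, []) = (a, (gateStep (S a) (A a) (k a))^[i] (w a, [])) := by
    intro a i
    induction i with
    | zero => rfl
    | succ i ih => rw [iterate_succ_apply', iterate_succ_apply', ih]
  have h := iterate (n := fun a => (w a).length) (x := fun a => (a, w a, [])) (by fun_prop)
    (by fun_prop) hstep (B := fun a => 2 * size a + 1 + (2 * size (w a) + 1 + 3 * size (w a)))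
    ((((PolyBounded.const 2).mul .size').add (.const 1)).add
      ((((PolyBounded.const 2).mul hw.polyBounded).add (.const 1)).add
        ((PolyBounded.const 3).mul hw.polyBounded))) fun a i hia => by
      rw [hi, size_pair]
      obtain ⟨h₁, h₂⟩ := gateStep_iterate_bounds (S a) (A a) (k a) (w a) i
      have h₃ := size_le_of_suffix h₁
      have h₄ := length_le_size (w a)
      have h₅ := size_pair ((gateStep (S a) (A a) (k a))^[i] (w a, [])).1
        ((gateStep (S a) (A a) (k a))^[i] (w a, [])).2
      rw [Prod.mk.eta, size_bits (Prod.snd _)] at h₅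
      omega
  simp only [hi] at h
  exact headD (reverse (snd (snd h))) false

end PolyTime

/-! ### Correctness of circuit evaluation -/

section

variable {k t : ℕ}

/-- `S` is handed the whole unread string, so `hS` has to allow for the codes of later gates after
the characteristic vector. -/
theorem gateStep_encodeGate {S : List Bool → Bool} {A : ℕ → Bool}
    {τ : Set.powersetCard (Fin k) t → Bool}
    (hS : ∀ (T : Set.powersetCard (Fin k) t) (l : List Bool),
      S ((List.ofFn fun i : Fin k => decide (i ∈ (T : Finset (Fin k)))) ++ l) = τ T)
    (g : Gate (Set.powersetCard (Fin k) t ⊕ ℕ)) (l vals : List Bool) :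
    gateStep S A k (encodeGate g ++ l, vals) =
      (l, vals ++ [g.eval (Sum.elim τ A) vals]) := by
  cases g with
  | var v =>
    cases v with
    | inl T =>
      simp only [gateStep, encodeGate, encodeVar, Gate.eval, Sum.elim_inl, List.cons_append,
        List.nil_append, List.isEmpty_cons, cond_false, List.getD_cons_zero, List.getD_cons_succ,
        add_comm 3 k, List.drop_succ_cons, List.drop_zero, hS]
      rw [List.drop_left' (List.length_ofFn)]
    | inr j =>
      simp [gateStep, encodeGate, encodeVar, Gate.eval, unary_encodeNat, skip_encodeNat]
  | neg i => simp [gateStep, encodeGate, Gate.eval, unary_encodeNat, skip_encodeNat]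
  | conj i j => simp [gateStep, encodeGate, Gate.eval, unary_encodeNat, skip_encodeNat]
  | disj i j => simp [gateStep, encodeGate, Gate.eval, unary_encodeNat, skip_encodeNat]

theorem encodeGate_ne_nil (g : Gate (Set.powersetCard (Fin k) t ⊕ ℕ)) : encodeGate g ≠ [] := by
  cases g <;> simp [encodeGate]

theorem evalCode_encodeCircuit {S : List Bool → Bool} {A : ℕ → Bool}
    {τ : Set.powersetCard (Fin k) t → Bool}
    (hS : ∀ (T : Set.powersetCard (Fin k) t) (l : List Bool),
      S ((List.ofFn fun i : Fin k => decide (i ∈ (T : Finset (Fin k)))) ++ l) = τ T)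
    (ψ : Circuit (Set.powersetCard (Fin k) t ⊕ ℕ)) :
    evalCode S A k (encodeCircuit ψ) = ψ.eval (Sum.elim τ A) := by
  -- Any number of steps not below the number of gates will do, since a step on the empty string
  -- changes nothing. The length of the code is such a number, as no gate has an empty code.
  have h : ∀ (gs : List (Gate (Set.powersetCard (Fin k) t ⊕ ℕ))) (m : ℕ) (vals : List Bool),
      gs.length ≤ m → (gateStep S A k)^[m] (gs.flatMap encodeGate, vals) =
        ([], gs.foldl (fun vals g => vals ++ [g.eval (Sum.elim τ A) vals]) vals) := by
    intro gs
    induction gs with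
    | nil =>
      intro m vals _
      exact iterate_fixed (by simp [gateStep]) m
    | cons g gs ih =>
      intro m vals hm
      obtain ⟨m, rfl⟩ : ∃ m', m = m' + 1 := ⟨m - 1, by simp at hm; omega⟩
      rw [iterate_succ_apply, List.flatMap_cons, gateStep_encodeGate hS,
        ih m _ (by simpa using hm), List.foldl_cons]
  have hlen : ∀ gs : List (Gate (Set.powersetCard (Fin k) t ⊕ ℕ)),
      gs.length ≤ (gs.flatMap encodeGate).length := by
    intro gs
    induction gs with
    | nil => simp
    | cons g gs ih =>
      have := List.length_pos_iff.2 (encodeGate_ne_nil g)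
      rw [List.flatMap_cons, List.length_append, List.length_cons]
      omega
  rw [evalCode, encodeCircuit, h _ _ _ (hlen _), Circuit.eval, gateValues]
  simp [List.headD_eq_head?_getD, List.getLastD_eq_getLast?]

/-- Finitely many additional variables suffice to witness that a circuit is satisfiable. -/
theorem satisfiableAt_iff (ψ : Circuit (Set.powersetCard (Fin k) t ⊕ ℕ))
    (τ : Set.powersetCard (Fin k) t → Bool) :
    ψ.SatisfiableAt τ ↔ ∃ l : List Bool, l.length ≤ (encodeCircuit ψ).length ∧
      ψ.eval (Sum.elim τ fun j => l.getD j false) = true := by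
  refine ⟨?_, fun ⟨l, _, hl⟩ => ⟨_, hl⟩⟩
  rintro ⟨η, hη⟩
  refine ⟨(List.range (encodeCircuit ψ).length).map η, by simp, ?_⟩
  rw [← hη, Circuit.eval, Circuit.eval, gateValues, gateValues]
  congr 1
  refine List.foldl_ext _ _ _ fun vals g hg => ?_
  congr 2
  cases g with
  | var v =>
    cases v with
    | inl T => rfl
    | inr j =>
      -- The number of an additional variable is written in unary, so a gate reading variable `j`
      -- alone occupies `j + 4` bits.
      have hj : j < (encodeCircuit ψ).length := by
        obtain ⟨gs, gs', h₁⟩ := List.append_of_mem hg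
        have h₂ : (encodeGate (k := k) (t := t) (.var (.inr j))).length = j + 4 := by
          simp [encodeGate, encodeVar, encodeNat]
        rw [encodeCircuit, h₁, List.flatMap_append, List.flatMap_cons, List.length_append,
          List.length_append, h₂]
        omega
      simp [Gate.eval, List.getD_eq_getElem?_getD, hj]
  | neg i => rfl
  | conj i j => rfl
  | disj i j => rfl

end

/-! ### Decision canonization with symmetry breaking circuits -/

/-- The number of points of the hypergraph of a graph with `n` vertices. -/
def numPoints (t n : ℕ) : ℕ := n + (t - 2) * (n + t)

/-- The value of a hypergraph at a characteristic vector; the embedding of the vertices is given by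
the numbers that `y` starts with. -/
def hypergraphBit (n : ℕ) (M y S : List Bool) : Bool :=
  (List.range n).any fun i => (List.range n).any fun j => adjBit n M i j &&
    (List.range n).all fun l => bif S.getD (unary (skips y l)) false
      then Nat.beq l i || Nat.beq l j else !(Nat.beq l i || Nat.beq l j)

/-- The string starts with a strictly increasing sequence of `n` numbers below `k`. -/
def isEmbedding (n k : ℕ) (y : List Bool) : Bool :=
  (List.range n).all fun i => Nat.ble (unary (skips y i) + 1) k &&
    (List.range n).all fun j => !(Nat.ble (i + 1) j) ||
      Nat.ble (unary (skips y i) + 1) (unary (skips y j))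

/-- The verifier for decision canonization, where `circ j` is the code of the circuit for
`t + 1 + j` points. -/
def canonVerifier (t : ℕ) (circ : ℕ → List Bool) (p : List Bool × List Bool) : Bool :=
  (startsWithGraph p.1 && (afterGraph p.1).isEmpty) && (Nat.ble (unary p.1) 2 ||
    isEmbedding (unary p.1) (numPoints t (unary p.1)) p.2 &&
    evalCode (hypergraphBit (unary p.1) (skip p.1) p.2)
      (fun j => (skips p.2 (unary p.1)).getD j false) (numPoints t (unary p.1))
      (circ (numPoints t (unary p.1) - (t + 1))))

namespace PolyTime

variable {α : Type} [Code α]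

@[fun_prop]
theorem numPoints (t : ℕ) {n : α → ℕ} (hn : PolyTime n) :
    PolyTime (fun a => numPoints t (n a)) := by
  unfold SymBreak.numPoints
  fun_prop

theorem canonVerifier (t : ℕ) {circ : ℕ → List Bool} (hc : PolyTime circ) :
    PolyTime (canonVerifier t circ) := by
  have h := evalCode (α := List Bool × List Bool)
    (S := fun p => hypergraphBit (SymBreak.unary p.1) (SymBreak.skip p.1) p.2)
    (A := fun p j => (SymBreak.skips p.2 (SymBreak.unary p.1)).getD j false)
    (k := fun p => SymBreak.numPoints t (SymBreak.unary p.1))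
    (w := fun p => circ (SymBreak.numPoints t (SymBreak.unary p.1) - (t + 1)))
    (by unfold hypergraphBit; fun_prop) (by fun_prop) (by fun_prop) (by fun_prop)
  unfold SymBreak.canonVerifier isEmbedding
  fun_prop

end PolyTime

/-! ### Correctness of the verifier for decision canonization -/

section

variable {n k t : ℕ}

theorem isEmbedding_iff {y : List Bool} : isEmbedding n k y = true ↔
    ∃ e : Fin n → Fin k, StrictMono e ∧ ∀ i : Fin n, unary (skips y i) = e i := by
  simp only [isEmbedding, List.all_eq_true, List.mem_range, Bool.and_eq_true, Nat.ble_eq,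
    Bool.or_eq_true, Bool.not_eq_true', Bool.eq_false_iff, ne_eq, Nat.succ_le_iff]
  constructor
  · intro h
    exact ⟨fun i => ⟨unary (skips y i), (h i i.2).1⟩, fun i j hij =>
      ((h i i.2).2 j j.2).resolve_left (not_not.2 hij), fun i => rfl⟩
  · rintro ⟨e, he, h⟩ i hi
    refine ⟨(h ⟨i, hi⟩).trans_lt (e _).2, fun j hj => or_iff_not_imp_left.2 fun hij => ?_⟩
    rw [h ⟨i, hi⟩, h ⟨j, hj⟩]
    exact he (not_not.1 hij)

theorem hypergraphBit_eq {Γ : SimpleGraph (Fin n)} {l y : List Bool} {e : Fin n → Fin k}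
    (he : ∀ i : Fin n, unary (skips y i) = e i) (S : Set.powersetCard (Fin k) t) (l' : List Bool) :
    hypergraphBit n (graphBits Γ ++ l) y
      ((List.ofFn fun i : Fin k => decide (i ∈ (S : Finset (Fin k)))) ++ l') =
      hypergraph t Γ e S := by
  classical
  have hS (v : Fin n) : ((List.ofFn fun i : Fin k => decide (i ∈ (S : Finset (Fin k)))) ++ l').getD
      (unary (skips y v)) false = decide (e v ∈ (S : Finset (Fin k))) := by
    rw [he, List.getD_append _ _ _ _ (by simp), List.getD_eq_getElem _ _ (by simp)]
    simp
  rw [Bool.eq_iff_iff, hypergraph, decide_eq_true_iff]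
  simp only [hypergraphBit, List.any_eq_true, List.mem_range, Bool.and_eq_true, List.all_eq_true]
  constructor
  · rintro ⟨i, hi, j, hj, hij, h⟩
    refine ⟨⟨i, hi⟩, ⟨j, hj⟩, ?_, fun v => ?_⟩
    · simpa [adjBit_graphBits Γ l ⟨i, hi⟩ ⟨j, hj⟩] using hij
    · have := h v v.2
      rw [hS v] at this
      by_cases hv : e v ∈ (S : Finset (Fin k)) <;> simpa [hv, Fin.ext_iff, Bool.eq_false_iff, Nat.beq_eq] using this
  · rintro ⟨i, j, hij, h⟩
    refine ⟨i, i.2, j, j.2, by simpa [adjBit_graphBits Γ l i j] using hij, fun v hv => ?_⟩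
    have := h ⟨v, hv⟩
    rw [hS ⟨v, hv⟩]
    by_cases hv' : e ⟨v, hv⟩ ∈ (S : Finset (Fin k)) <;> simpa [hv', Fin.ext_iff, Bool.eq_false_iff, Nat.beq_eq] using this

/-- The code of a circuit is assumed only for `2 < n`: for `t = 2` there are `n` points, and the
group is defined only for more than `t` of them. -/
theorem canonVerifier_iff {circ : ℕ → List Bool}
    {ψ : Circuit (Set.powersetCard (Fin (numPoints t n)) t ⊕ ℕ)}
    (hψ : 2 < n → circ (numPoints t n - (t + 1)) = encodeCircuit ψ) (Γ : SimpleGraph (Fin n)) (y : List Bool) :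
    canonVerifier t circ (encodeGraph Γ, y) = true ↔ n ≤ 2 ∨
      ∃ e : Fin n → Fin (numPoints t n), StrictMono e ∧ (∀ i : Fin n, unary (skips y i) = e i) ∧
        ψ.eval (Sum.elim (hypergraph t Γ e) fun j => (skips y n).getD j false) = true := by
  have h₁ := unary_encodeGraph Γ []
  have h₂ := skip_encodeGraph Γ []
  have h₃ := afterGraph_encodeGraph Γ []
  have h₄ := startsWithGraph_iff.2 ⟨n, Γ, [], rfl⟩
  simp only [List.append_nil] at h₁ h₂ h₃ h₄
  rcases Nat.lt_or_ge 2 n with hn | hn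
  · simp only [canonVerifier, h₁, h₂, h₃, h₄, hψ hn, List.isEmpty_nil, Bool.and_self,
      Bool.true_and, Bool.or_eq_true, Nat.ble_eq, Bool.and_eq_true]
    refine or_congr_right ?_
    rw [isEmbedding_iff]
    constructor
    · rintro ⟨⟨e, he, hy⟩, h⟩
      refine ⟨e, he, hy, ?_⟩
      rwa [← evalCode_encodeCircuit (hypergraphBit_eq (l := []) hy), List.append_nil]
    · rintro ⟨e, he, hy, h⟩
      refine ⟨⟨e, he, hy⟩, ?_⟩
      rwa [← evalCode_encodeCircuit (hypergraphBit_eq (l := []) hy), List.append_nil] at h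
  · simp [canonVerifier, h₁, h₃, h₄, hn]

/-- The certificate lists the images of the vertices in unary, at most `k + 1` bits each, followed
by the values of sufficiently many additional variables. -/
theorem exists_certificate (ψ : Circuit (Set.powersetCard (Fin k) t ⊕ ℕ))
    (Γ : SimpleGraph (Fin n)) :
    (∃ e : Fin n → Fin k, StrictMono e ∧ ψ.SatisfiableAt (hypergraph t Γ e)) ↔
    ∃ y : List Bool, y.length ≤ n * (k + 1) + (encodeCircuit ψ).length ∧
      ∃ e : Fin n → Fin k, StrictMono e ∧ (∀ i : Fin n, unary (skips y i) = e i) ∧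
        ψ.eval (Sum.elim (hypergraph t Γ e) fun j => (skips y n).getD j false) = true := by
  constructor
  · rintro ⟨e, he, h⟩
    obtain ⟨l, hl, h⟩ := (satisfiableAt_iff ψ _).1 h
    have hy := skips_flatMap (List.ofFn fun i => (e i : ℕ)) l
    rw [List.length_ofFn] at hy
    refine ⟨(List.ofFn fun i => (e i : ℕ)).flatMap encodeNat ++ l, ?_, e, he, fun i => ?_,
      by rwa [hy]⟩
    · have := length_flatMap_encodeNat_le e
      rw [List.length_append]
      omega
    · rw [unary_skips_flatMap _ _ (by simp)]
      simp
  · rintro ⟨y, -, e, he, -, h⟩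
    exact ⟨e, he, _, h⟩

/-- On at most two vertices, a bijection either fixes a given pair of distinct vertices or exchanges
its ends. -/
theorem eq_of_iso_of_le_two (hn : n ≤ 2) {Γ Δ : SimpleGraph (Fin n)} (φ : Γ ≃g Δ) : Γ = Δ := by
  ext i j
  rcases eq_or_ne i j with rfl | hij
  · simp
  have hφ : φ i ≠ φ j := φ.injective.ne hij
  rw [← φ.map_adj_iff]
  have : φ i = i ∧ φ j = j ∨ φ i = j ∧ φ j = i := by
    simp only [Fin.ext_iff, ne_eq] at hij hφ ⊢
    have := (φ i).2
    have := (φ j).2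
    omega
  rcases this with h | h
  · rw [h.1, h.2]
  · rw [h.1, h.2, Δ.adj_comm]

end

/-! ### From symmetry breaking circuits to a canonical form -/

/-- The factor `t - 2` vanishes for `t = 2`; for `t ≥ 3` there are at least `2 * n + t` points. -/
theorem numPoints_spec {t n : ℕ} (ht : 2 ≤ t) (hn : 2 < n) : t < numPoints t n ∧
    (t = 2 ∧ numPoints t n = n ∨ 3 ≤ t ∧ 2 * n < numPoints t n ∧ n + t ≤ numPoints t n) := by
  rcases ht.eq_or_lt with rfl | ht
  · simp [numPoints, hn]
  · have : 1 * (n + t) ≤ (t - 2) * (n + t) := Nat.mul_le_mul_right _ (by omega)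
    unfold numPoints
    omega

/-- Indexing by `k - (t + 1)` makes the generation of circuits a total function of a number. It is
polynomial because `k.choose t ≤ k ^ t` with `t` fixed. -/
theorem exists_codes {t : ℕ} (h : JohnsonSymmetryBreakingInPolyTime t) :
    ∃ (ψ : ∀ k, Circuit (Set.powersetCard (Fin k) t ⊕ ℕ)) (circ : ℕ → List Bool),
      (∀ k, t < k → IsCompleteSymmetryBreaking (johnsonGroup k t) (ψ k)) ∧
      (∀ k, t < k → circ (k - (t + 1)) = encodeCircuit (ψ k)) ∧ PolyTime circ := by
  obtain ⟨c, p, h⟩ := h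
  have h' (k : ℕ) : ∃ ψ : Circuit (Set.powersetCard (Fin k) t ⊕ ℕ), t < k →
      IsCompleteSymmetryBreaking (johnsonGroup k t) ψ ∧
      OutputsWithin c [List.replicate k true] (p.eval (k.choose t)) (encodeCircuit ψ) := by
    by_cases hk : t < k
    · obtain ⟨ψ, hψ⟩ := h k hk
      exact ⟨ψ, fun _ => hψ⟩
    · exact ⟨⟨[.var (.inr 0)], by simp, by simp [Gate.args]⟩, fun h => absurd h hk⟩
  choose ψ hψ using h'
  refine ⟨ψ, fun j => encodeCircuit (ψ (t + 1 + j)), fun k hk => (hψ k hk).1, fun k hk => ?_, ?_⟩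
  · beta_reduce
    rw [Nat.add_sub_cancel' hk]
  have hT : PolyBounded fun j : ℕ => p.eval ((t + 1 + j).choose t) := by
    refine PolyBounded.eval (PolyBounded.mono (PolyBounded.eval (g := fun j : ℕ => t + 1 + j) ?_
      (Polynomial.X ^ t)) fun j => ?_) p
    · exact ((PolyBounded.const (t + 1)).add .size').mono fun j => by rw [size_nat]
    · simpa using Nat.choose_le_pow _ _
  -- The second input `()` has the empty code, so the store is that of the single input.
  have := PolyTime.of_program (x := fun j : ℕ => t + 1 + j) (y := fun _ => ())
    (f := fun j => RawString.mk (encodeCircuit (ψ (t + 1 + j)))) (by fun_prop) (by fun_prop) c hT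
    fun j => by
      obtain ⟨n, hn, s, hs, hout⟩ := (hψ (t + 1 + j) (by omega)).2
      refine ⟨n, hn, s, ?_, hout⟩
      convert hs using 1
      funext i
      rcases i with - | - | i <;> rfl
  exact this.bits

theorem exists_canonicalForm {t : ℕ} (ht : 2 ≤ t) (h : JohnsonSymmetryBreakingInPolyTime t) :
    ∃ f : ∀ n : ℕ, SimpleGraph (Fin n) → SimpleGraph (Fin n),
      IsCanonicalForm f ∧ dGCanon f ∈ NP := by
  obtain ⟨ψ, circ, hψ, hcirc, hpoly⟩ := exists_codes h
  -- The canonical form of `Γ` is the one graph in its isomorphism class that the circuit accepts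
  -- under some increasing embedding.
  have hex (n : ℕ) (Γ : SimpleGraph (Fin n)) : ∃! Γ' : SimpleGraph (Fin n), Nonempty (Γ' ≃g Γ) ∧
      (n ≤ 2 ∨ ∃ e : Fin n → Fin (numPoints t n), StrictMono e ∧
        (ψ (numPoints t n)).SatisfiableAt (hypergraph t Γ' e)) := by
    rcases Nat.lt_or_ge 2 n with hn | hn
    · have := numPoints_spec ht hn
      simpa [hn.not_ge] using existsUnique_satisfiableAt (hψ _ this.1) this.2 Γ
    · exact ⟨Γ, ⟨⟨.refl⟩, .inl hn⟩, fun Γ' ⟨⟨φ⟩, _⟩ => eq_of_iso_of_le_two hn φ⟩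
  choose f hf huniq using hex
  refine ⟨f, ⟨fun n Γ Δ => ⟨?_, fun h => ?_⟩, fun n Γ => (hf n Γ).1⟩, ?_⟩
  · rintro ⟨φ⟩
    obtain ⟨⟨φ'⟩, h⟩ := hf n Γ
    exact huniq n Δ _ ⟨⟨φ'.trans φ⟩, h⟩
  · obtain ⟨φ⟩ := (hf n Γ).1
    obtain ⟨φ'⟩ := (hf n Δ).1
    exact ⟨φ.symm.trans (h ▸ φ')⟩
  -- By uniqueness, a graph is its own canonical form exactly if it has the selecting property,
  -- which is what certificates witness.
  have hfix (n : ℕ) (Γ : SimpleGraph (Fin n)) : f n Γ = Γ ↔ n ≤ 2 ∨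
      ∃ e : Fin n → Fin (numPoints t n), StrictMono e ∧
        (ψ (numPoints t n)).SatisfiableAt (hypergraph t Γ e) :=
    ⟨fun h => by simpa only [h] using (hf n Γ).2, fun h => (huniq n Γ Γ ⟨⟨.refl⟩, h⟩).symm⟩
  have hb : PolyTime fun n : ℕ => n * (numPoints t n + 1) +
      (circ (numPoints t n - (t + 1))).length := by fun_prop
  -- The bound on certificates is itself computable in polynomial time with `n` in unary, hence
  -- bounded by a polynomial in `n`.
  obtain ⟨q, hq⟩ := hb.polyBounded
  refine ⟨fun x y => canonVerifier t circ (x, y) = true, q,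
    polyTimeDecidable_of_polyTime (PolyTime.canonVerifier t hpoly) fun x y => Iff.rfl, fun x => ?_⟩
  have hver {n : ℕ} (Γ : SimpleGraph (Fin n)) (y : List Bool) :=
    canonVerifier_iff (fun hn => hcirc _ (numPoints_spec ht hn).1) Γ y
  constructor
  · rintro ⟨n, Γ, hΓ, rfl⟩
    rcases (hfix n Γ).1 hΓ with hn | h
    · exact ⟨[], by simp, (hver Γ []).2 (.inl hn)⟩
    · rcases Nat.lt_or_ge 2 n with hn | hn
      · obtain ⟨y, hy, h⟩ := (exists_certificate _ Γ).1 h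
        refine ⟨y, hy.trans ?_, (hver Γ y).2 (.inr h)⟩
        have h₁ := hq n
        simp only [size_nat, hcirc _ (numPoints_spec ht hn).1] at h₁
        refine h₁.trans (eval_mono q ?_)
        rw [length_encodeGraph]
        omega
      · exact ⟨[], by simp, (hver Γ []).2 (.inl hn)⟩
  · rintro ⟨y, -, hy⟩
    have hv := hy
    simp only [canonVerifier, Bool.and_eq_true, startsWithGraph_iff] at hv
    obtain ⟨⟨⟨n, Γ, l, rfl⟩, hl⟩, -⟩ := hv
    rw [afterGraph_encodeGraph, List.isEmpty_iff] at hl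
    subst hl
    rw [List.append_nil] at hy ⊢
    refine ⟨n, Γ, (hfix n Γ).2 (((hver Γ y).1 hy).imp_right fun ⟨e, he, _, h⟩ => ⟨e, he, _, h⟩), rfl⟩

/-! ### Graph nonisomorphism -/

/-- The string starts with a permutation of `0, …, n - 1`. -/
def isPermutation (n : ℕ) (y : List Bool) : Bool :=
  (List.range n).all fun i => Nat.ble (unary (skips y i) + 1) n &&
    (List.range n).all fun j => !(Nat.beq (unary (skips y i)) (unary (skips y j))) || Nat.beq i j

/-- Permute the rows and columns of an adjacency matrix. -/
def permuteBits (n : ℕ) (M y : List Bool) : List Bool :=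
  (List.range n).flatMap fun i => (List.range n).map fun j =>
    adjBit n M (unary (skips y i)) (unary (skips y j))

/-- Two adjacency matrices are different. -/
def bitsDiffer (n : ℕ) (M M' : List Bool) : Bool :=
  (List.range n).any fun i => (List.range n).any fun j =>
    bif adjBit n M i j then !(adjBit n M' i j) else adjBit n M' i j

/-- The verifier `d` for the certificate `w` of length at most `b`, applied to a permuted graph. -/
def permutedVerifier (d : List Bool × List Bool → Bool) (b : ℕ → ℕ) (n : ℕ) (M y w : List Bool) :
    Bool :=
  isPermutation n y && (Nat.ble w.length (b (encodeNat n ++ permuteBits n M y).length) &&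
    d (encodeNat n ++ permuteBits n M y, w))

/-- The certificate gives two permutations and certificates that the permuted graphs are canonical
forms. -/
def canonicalPair (d : List Bool × List Bool → Bool) (b : ℕ → ℕ) (n : ℕ) (M M' y : List Bool) :
    Bool :=
  (permutedVerifier d b n M y
      ((skip (skips y (n + n))).take (unary (skips y (n + n)))) &&
    permutedVerifier d b n M' (skips y n)
      ((skip (skips y (n + n))).drop (unary (skips y (n + n))))) &&
    bitsDiffer n (permuteBits n M y) (permuteBits n M' (skips y n))

/-- The string is the code of a pair of graphs. -/
def isGraphPair (x : List Bool) : Bool :=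
  startsWithGraph x && (startsWithGraph (afterGraph x) && (afterGraph (afterGraph x)).isEmpty)

/-- The verifier for graph nonisomorphism. -/
def nonIsoVerifier (d : List Bool × List Bool → Bool) (b : ℕ → ℕ) (p : List Bool × List Bool) :
    Bool :=
  !(isGraphPair p.1) || (!(Nat.beq (unary p.1) (unary (afterGraph p.1))) ||
    canonicalPair d b (unary p.1) (skip p.1) (skip (afterGraph p.1)) p.2)

namespace PolyTime

variable {α : Type} [Code α]

@[fun_prop]
theorem take {l : α → List Bool} {n : α → ℕ} (hl : PolyTime l) (hn : PolyTime n) :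
    PolyTime (fun a => (l a).take (n a)) := by
  have : PolyTime (fun a => ((l a).reverse.drop ((l a).length - n a)).reverse) := by fun_prop
  convert this using 2 with a
  rw [List.drop_reverse, List.reverse_reverse]
  rcases le_total (n a) (l a).length with h | h
  · rw [Nat.sub_sub_self h]
  · rw [List.take_of_length_le h, List.take_of_length_le (by omega)]

@[fun_prop]
theorem encodeNat {n : α → ℕ} (hn : PolyTime n) : PolyTime (fun a => encodeNat (n a)) := by
  have : PolyTime (fun a => (List.range (n a)).map (fun _ => true) ++ [false]) := by fun_prop
  convert this using 2 with a
  simp [SymBreak.encodeNat]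

/-- The nonisomorphism verifier has to check the lengths of the inner certificates, since overlong
strings may be accepted for graphs that are not canonical. -/
theorem eval (p : Polynomial ℕ) : PolyTime (fun n : ℕ => p.eval n) := by
  induction p using Polynomial.induction_on' with
  | add p q hp hq =>
    simp only [Polynomial.eval_add]
    fun_prop
  | monomial k c =>
    simp only [Polynomial.eval_monomial]
    induction k with
    | zero => simp only [pow_zero]; fun_prop
    | succ k ih => simp only [pow_succ, ← mul_assoc]; fun_prop

@[fun_prop]
theorem permuteBits {n : α → ℕ} {M y : α → List Bool} (hn : PolyTime n) (hM : PolyTime M)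
    (hy : PolyTime y) : PolyTime (fun a => permuteBits (n a) (M a) (y a)) := by
  unfold SymBreak.permuteBits
  fun_prop

theorem permutedVerifier {d : List Bool × List Bool → Bool} {b : ℕ → ℕ} (hd : PolyTime d)
    (hb : PolyTime b) {n : α → ℕ} {M y w : α → List Bool} (hn : PolyTime n) (hM : PolyTime M)
    (hy : PolyTime y) (hw : PolyTime w) :
    PolyTime (fun a => permutedVerifier d b (n a) (M a) (y a) (w a)) := by
  unfold SymBreak.permutedVerifier isPermutation
  fun_prop

theorem nonIsoVerifier {d : List Bool × List Bool → Bool} {b : ℕ → ℕ} (hd : PolyTime d)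
    (hb : PolyTime b) : PolyTime (nonIsoVerifier d b) := by
  have h₁ := permutedVerifier hd hb (n := fun p : List Bool × List Bool => SymBreak.unary p.1)
    (M := fun p => SymBreak.skip p.1) (y := fun p => p.2)
    (w := fun p => (SymBreak.skip (SymBreak.skips p.2 (SymBreak.unary p.1 + SymBreak.unary p.1))).take
      (SymBreak.unary (SymBreak.skips p.2 (SymBreak.unary p.1 + SymBreak.unary p.1))))
    (by fun_prop) (by fun_prop) (by fun_prop) (by fun_prop)
  have h₂ := permutedVerifier hd hb (n := fun p : List Bool × List Bool => SymBreak.unary p.1)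
    (M := fun p => SymBreak.skip (SymBreak.afterGraph p.1))
    (y := fun p => SymBreak.skips p.2 (SymBreak.unary p.1))
    (w := fun p => (SymBreak.skip (SymBreak.skips p.2 (SymBreak.unary p.1 + SymBreak.unary p.1))).drop
      (SymBreak.unary (SymBreak.skips p.2 (SymBreak.unary p.1 + SymBreak.unary p.1))))
    (by fun_prop) (by fun_prop) (by fun_prop) (by fun_prop)
  have h₃ : PolyTime (fun p : List Bool × List Bool => bitsDiffer (SymBreak.unary p.1)
      (SymBreak.permuteBits (SymBreak.unary p.1) (SymBreak.skip p.1) p.2)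
      (SymBreak.permuteBits (SymBreak.unary p.1) (SymBreak.skip (SymBreak.afterGraph p.1))
        (SymBreak.skips p.2 (SymBreak.unary p.1)))) := by
    unfold bitsDiffer
    fun_prop
  have h₄ : PolyTime (fun p : List Bool × List Bool => isGraphPair p.1) := by
    unfold isGraphPair
    fun_prop
  exact (not h₄).or ((not (by fun_prop)).or ((h₁.and h₂).and h₃))

end PolyTime

/-! ### Soundness and completeness of certificates for nonisomorphism -/

section

variable {n : ℕ}

theorem isPermutation_iff {y : List Bool} : isPermutation n y = true ↔
    ∃ π : Equiv.Perm (Fin n), ∀ i : Fin n, unary (skips y i) = π i := by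
  simp only [isPermutation, List.all_eq_true, List.mem_range, Bool.and_eq_true, Nat.ble_eq,
    Bool.or_eq_true, Bool.not_eq_true', Bool.eq_false_iff, ne_eq, Nat.beq_eq, Nat.succ_le_iff]
  constructor
  · intro h
    let e : Fin n → Fin n := fun i => ⟨unary (skips y i), (h i i.2).1⟩
    have he : Injective e := fun i j hij =>
      Fin.ext (((h i i.2).2 j j.2).resolve_left (not_not.2 (Fin.ext_iff.1 hij)))
    exact ⟨Equiv.ofBijective e (Finite.injective_iff_bijective.1 he), fun i => rfl⟩
  · rintro ⟨π, h⟩ i hi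
    refine ⟨(h ⟨i, hi⟩).trans_lt (π _).2, fun j hj => or_iff_not_imp_left.2 fun hij => ?_⟩
    rw [not_not, h ⟨i, hi⟩, h ⟨j, hj⟩] at hij
    exact Fin.ext_iff.1 (π.injective (Fin.ext hij))

theorem permuteBits_graphBits {Γ : SimpleGraph (Fin n)} {l y : List Bool} {π : Equiv.Perm (Fin n)}
    (hπ : ∀ i : Fin n, unary (skips y i) = π i) :
    permuteBits n (graphBits Γ ++ l) y = graphBits (Γ.comap π) := by
  have hr : List.range n = List.ofFn fun i : Fin n => (i : ℕ) :=
    List.ext_getElem (by simp) (by simp)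
  rw [permuteBits, List.flatMap_def, hr, List.map_ofFn]
  conv_rhs => rw [graphBits]
  congr 2
  funext i
  rw [comp_apply, List.map_ofFn]
  congr 1
  funext j
  rw [comp_apply, hπ, hπ, adjBit_graphBits]
  rfl

theorem bitsDiffer_iff {Γ Δ : SimpleGraph (Fin n)} :
    bitsDiffer n (graphBits Γ) (graphBits Δ) = true ↔ Γ ≠ Δ := by
  have h (Γ : SimpleGraph (Fin n)) (i j : Fin n) := adjBit_graphBits Γ [] i j
  simp only [List.append_nil] at h
  simp only [bitsDiffer, List.any_eq_true, List.mem_range]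
  constructor
  · rintro ⟨i, hi, j, hj, hij⟩ rfl
    cases e : adjBit n (graphBits Γ) i j <;> simp [e] at hij
  · intro hne
    by_contra hcon
    push Not at hcon
    refine hne (SimpleGraph.ext ?_)
    ext i j
    have := hcon i i.2 j j.2
    rw [h, h] at this
    by_cases h₁ : Γ.Adj i j <;> by_cases h₂ : Δ.Adj i j <;> simp_all

theorem encodeGraph_mem_dGCanon {f : ∀ n : ℕ, SimpleGraph (Fin n) → SimpleGraph (Fin n)}
    {Γ : SimpleGraph (Fin n)} : encodeGraph Γ ∈ dGCanon f ↔ f n Γ = Γ := by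
  refine ⟨?_, fun h => ⟨n, Γ, h, rfl⟩⟩
  rintro ⟨m, Δ, hΔ, h⟩
  have h' : encodeGraph Γ ++ [] = encodeGraph Δ ++ [] := by rw [h]
  obtain rfl := unary_eq_of_encodeGraph_append h'
  obtain rfl := (encodeGraph_append_inj h').1
  exact hΔ

theorem append_mem_GI {m : ℕ} {Γ : SimpleGraph (Fin n)} {Δ : SimpleGraph (Fin m)} :
    encodeGraph Γ ++ encodeGraph Δ ∈ GI ↔ Nonempty (Γ ≃g Δ) := by
  refine ⟨?_, fun h => ⟨n, m, Γ, Δ, h, rfl⟩⟩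
  rintro ⟨n', m', Γ', Δ', hiso, h⟩
  obtain rfl := unary_eq_of_encodeGraph_append h
  obtain ⟨rfl, hΔ⟩ := encodeGraph_append_inj h
  have h' : encodeGraph Δ ++ [] = encodeGraph Δ' ++ [] := by rw [hΔ]
  obtain rfl := unary_eq_of_encodeGraph_append h'
  obtain rfl := (encodeGraph_append_inj h').1
  exact hiso

theorem isGraphPair_iff {x : List Bool} : isGraphPair x = true ↔
    ∃ (n m : ℕ) (Γ : SimpleGraph (Fin n)) (Δ : SimpleGraph (Fin m)),
      x = encodeGraph Γ ++ encodeGraph Δ := by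
  simp only [isGraphPair, Bool.and_eq_true, startsWithGraph_iff]
  constructor
  · rintro ⟨⟨n, Γ, l, rfl⟩, ⟨m, Δ, l', h⟩, hl⟩
    rw [afterGraph_encodeGraph] at h
    subst h
    rw [afterGraph_encodeGraph, afterGraph_encodeGraph, List.isEmpty_iff] at hl
    subst hl
    exact ⟨n, m, Γ, Δ, by rw [List.append_nil]⟩
  · rintro ⟨n, m, Γ, Δ, rfl⟩
    have := afterGraph_encodeGraph Δ []
    rw [List.append_nil] at this
    exact ⟨⟨n, Γ, _, rfl⟩, ⟨m, Δ, [], by rw [afterGraph_encodeGraph, List.append_nil]⟩,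
      by rw [afterGraph_encodeGraph, this]; rfl⟩

theorem comap_iso_eq {Γ Γ' : SimpleGraph (Fin n)} (φ : Γ' ≃g Γ) : Γ.comap φ.toEquiv = Γ' := by
  ext i j
  exact φ.map_adj_iff

variable {f : ∀ n : ℕ, SimpleGraph (Fin n) → SimpleGraph (Fin n)} {p : Polynomial ℕ}
  {d : List Bool × List Bool → Bool}

/-- Acceptance means that some relabelling of the graph is a fixed point of `f`; conversely, a
relabelling with a short certificate is accepted. -/
theorem permutedVerifier_iff
    (hd : ∀ x, x ∈ dGCanon f ↔ ∃ y : List Bool, y.length ≤ p.eval x.length ∧ d (x, y) = true)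
    {Γ : SimpleGraph (Fin n)} {l y w : List Bool} :
    (permutedVerifier d (fun m => p.eval m) n (graphBits Γ ++ l) y w = true →
      ∃ π : Equiv.Perm (Fin n), permuteBits n (graphBits Γ ++ l) y = graphBits (Γ.comap π) ∧
        f n (Γ.comap π) = Γ.comap π) ∧
    (∀ π : Equiv.Perm (Fin n), (∀ i : Fin n, unary (skips y i) = π i) →
      w.length ≤ p.eval (encodeGraph (Γ.comap π)).length → d (encodeGraph (Γ.comap π), w) = true →
      permutedVerifier d (fun m => p.eval m) n (graphBits Γ ++ l) y w = true) := by
  simp only [permutedVerifier, Bool.and_eq_true, isPermutation_iff, Nat.ble_eq]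
  constructor
  · rintro ⟨⟨π, hπ⟩, hw, h⟩
    have e := permuteBits_graphBits (Γ := Γ) (l := l) hπ
    rw [e, ← encodeGraph_eq] at hw h
    exact ⟨π, e, encodeGraph_mem_dGCanon.1 ((hd _).2 ⟨w, hw, h⟩)⟩
  · intro π hπ hw h
    rw [permuteBits_graphBits hπ, ← encodeGraph_eq]
    exact ⟨⟨π, hπ⟩, hw, h⟩

/-- An isomorphism from `f n Γ` to `Γ` is a permutation that relabels `Γ` as `f n Γ`, and `f` fixes
its values. The canonical forms of nonisomorphic graphs differ. -/
theorem exists_canonicalPair (hf : IsCanonicalForm f)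
    (hd : ∀ x, x ∈ dGCanon f ↔ ∃ y : List Bool, y.length ≤ p.eval x.length ∧ d (x, y) = true)
    {Γ Δ : SimpleGraph (Fin n)} (hne : ¬ Nonempty (Γ ≃g Δ)) (l l' : List Bool) :
    ∃ y : List Bool, y.length ≤ 2 * (n * (n + 1)) + 3 * p.eval (n + 1 + n * n) + 1 ∧
      canonicalPair d (fun m => p.eval m) n (graphBits Γ ++ l) (graphBits Δ ++ l') y = true := by
  have hcanon (Γ : SimpleGraph (Fin n)) : ∃ (π : Equiv.Perm (Fin n)) (w : List Bool),
      Γ.comap π = f n Γ ∧ w.length ≤ p.eval (encodeGraph (Γ.comap π)).length ∧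
      d (encodeGraph (Γ.comap π), w) = true := by
    obtain ⟨φ⟩ := hf.iso_self n Γ
    have hφ := comap_iso_eq φ
    have hmem : f n (Γ.comap φ.toEquiv) = Γ.comap φ.toEquiv := by
      rw [hφ]
      exact (hf.iso_iff n _ _).1 ⟨φ⟩
    obtain ⟨w, hw⟩ := (hd _).1 (encodeGraph_mem_dGCanon.2 hmem)
    exact ⟨φ.toEquiv, w, hφ, hw⟩
  obtain ⟨π, w, hπ, hw, hdw⟩ := hcanon Γ
  obtain ⟨σ, w', hσ, hw', hdw'⟩ := hcanon Δ
  let P := List.ofFn fun i => (π i : ℕ)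
  let Q := List.ofFn fun i => (σ i : ℕ)
  -- The length of `w` tells where `w'` begins. Written in unary it accounts for the third summand
  -- `p.eval` and the final `1` in the length bound.
  let z := encodeNat w.length ++ (w ++ w')
  have hn : P.length = n := List.length_ofFn
  have hn' : Q.length = n := List.length_ofFn
  have h₁ : skips (P.flatMap encodeNat ++ (Q.flatMap encodeNat ++ z)) n
      = Q.flatMap encodeNat ++ z := by
    conv_lhs => rw [← hn]
    exact skips_flatMap P _
  have h₂ : skips (P.flatMap encodeNat ++ (Q.flatMap encodeNat ++ z)) (n + n) = z := by
    rw [skips_add, h₁]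
    conv_lhs => rw [← hn']
    exact skips_flatMap Q _
  refine ⟨P.flatMap encodeNat ++ (Q.flatMap encodeNat ++ z), ?_, ?_⟩
  · have hP := length_flatMap_encodeNat_le π
    have hQ := length_flatMap_encodeNat_le σ
    rw [length_encodeGraph] at hw hw'
    simp only [List.length_append, P, Q, z, encodeNat, List.length_replicate,
      List.length_singleton] at hP hQ ⊢
    omega
  · have hπ' (i : Fin n) : unary (skips (P.flatMap encodeNat ++ (Q.flatMap encodeNat ++ z)) i)
        = π i := by
      rw [unary_skips_flatMap P _ (by rw [hn]; exact i.2)]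
      simp [P]
    have hσ' (i : Fin n) : unary (skips (Q.flatMap encodeNat ++ z) i) = σ i := by
      rw [unary_skips_flatMap Q _ (by rw [hn']; exact i.2)]
      simp [Q]
    simp only [canonicalPair, h₁, h₂, z, unary_encodeNat, skip_encodeNat, List.take_left,
      List.drop_left, Bool.and_eq_true, permuteBits_graphBits hπ', permuteBits_graphBits hσ',
      bitsDiffer_iff]
    refine ⟨⟨(permutedVerifier_iff hd).2 π hπ' hw hdw, (permutedVerifier_iff hd).2 σ hσ' hw' hdw'⟩,
      ?_⟩
    rw [hπ, hσ]
    exact fun h => hne ((hf.iso_iff n Γ Δ).2 h)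
-- For isomorphic graphs, both relabelled graphs would be fixed points of `f` in one isomorphism
-- class, hence equal, contrary to the last check.
theorem not_nonempty_iso_of_canonicalPair (hf : IsCanonicalForm f)
    (hd : ∀ x, x ∈ dGCanon f ↔ ∃ y : List Bool, y.length ≤ p.eval x.length ∧ d (x, y) = true)
    {Γ Δ : SimpleGraph (Fin n)} {l l' y : List Bool}
    (hy : canonicalPair d (fun m => p.eval m) n (graphBits Γ ++ l) (graphBits Δ ++ l') y = true) :
    ¬ Nonempty (Γ ≃g Δ) := by
  intro hiso
  simp only [canonicalPair, Bool.and_eq_true] at hy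
  obtain ⟨⟨h₁, h₂⟩, h₃⟩ := hy
  obtain ⟨π, e₁, hπ⟩ := (permutedVerifier_iff hd).1 h₁
  obtain ⟨σ, e₂, hσ⟩ := (permutedVerifier_iff hd).1 h₂
  rw [e₁, e₂, bitsDiffer_iff] at h₃
  apply h₃
  rw [← hπ, ← hσ, ← hf.iso_iff]
  obtain ⟨φ⟩ := hiso
  exact ⟨((SimpleGraph.Iso.comap π Γ).trans φ).trans (SimpleGraph.Iso.comap σ Δ).symm⟩

end

/-! ### Graph isomorphism is in coNP -/

theorem GI_mem_coNP {f : ∀ n : ℕ, SimpleGraph (Fin n) → SimpleGraph (Fin n)}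
    (hf : IsCanonicalForm f) (h : dGCanon f ∈ NP) : GI ∈ coNP := by
  obtain ⟨R, p, hR, hL⟩ := h
  obtain ⟨d, hd, hdR⟩ := hR.exists_polyTime
  have hd' : ∀ x, x ∈ dGCanon f ↔
      ∃ y : List Bool, y.length ≤ p.eval x.length ∧ d (x, y) = true := by
    simpa only [hdR] using hL
  refine ⟨fun x y => nonIsoVerifier d (fun m => p.eval m) (x, y) = true,
    Polynomial.C 2 * (Polynomial.X * (Polynomial.X + Polynomial.C 1)) + Polynomial.C 3 * p +
      Polynomial.C 1, polyTimeDecidable_of_polyTime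
      (PolyTime.nonIsoVerifier hd (PolyTime.eval p)) fun x y => Iff.rfl, fun x => ?_⟩
  rw [Set.mem_compl_iff]
  by_cases hx : isGraphPair x = true
  swap
  -- A string that is not a pair of graphs belongs to the complement and is accepted with the empty
  -- certificate.
  · refine iff_of_true ?_ ⟨[], by simp, by simp [nonIsoVerifier, hx]⟩
    rintro ⟨n, m, Γ, Δ, -, rfl⟩
    exact hx (isGraphPair_iff.2 ⟨n, m, Γ, Δ, rfl⟩)
  obtain ⟨n, m, Γ, Δ, rfl⟩ := isGraphPair_iff.1 hx
  have hu := unary_encodeGraph Δ []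
  rw [List.append_nil] at hu
  rcases eq_or_ne n m with rfl | hnm
  · have hs := skip_encodeGraph Δ []
    rw [List.append_nil] at hs
    simp only [append_mem_GI, nonIsoVerifier, hx, unary_encodeGraph, afterGraph_encodeGraph, hu, hs,
      skip_encodeGraph, Bool.not_true, Bool.false_or, Bool.or_eq_true, Bool.not_eq_true',
      Bool.eq_false_iff, ne_eq, Nat.beq_eq, not_true_eq_false, false_or]
    constructor
    · intro hne
      obtain ⟨y, hy, h⟩ := exists_canonicalPair hf hd' hne (encodeGraph Δ) []
      refine ⟨y, hy.trans ?_, h⟩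
      have hl : n + 1 + n * n ≤ (encodeGraph Γ ++ encodeGraph Δ).length := by
        rw [List.length_append, length_encodeGraph]
        omega
      have h₁ := eval_mono p hl
      have h₂ : n * (n + 1) ≤ (encodeGraph Γ ++ encodeGraph Δ).length *
          ((encodeGraph Γ ++ encodeGraph Δ).length + 1) :=
        Nat.mul_le_mul (by omega) (by omega)
      simp only [Polynomial.eval_add, Polynomial.eval_mul, Polynomial.eval_C, Polynomial.eval_X]
      omega
    · rintro ⟨y, -, h⟩
      exact not_nonempty_iso_of_canonicalPair hf hd' h
  -- Different numbers of vertices rule out an isomorphism, so again the empty certificate suffices.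
  · refine iff_of_true (fun h => ?_) ⟨[], by simp, ?_⟩
    · obtain ⟨φ⟩ := append_mem_GI.1 h
      exact hnm (by simpa using Fintype.card_congr φ.toEquiv)
    · have : Nat.beq n m = false := by simpa [Bool.eq_false_iff, Nat.beq_eq] using hnm
      simp [nonIsoVerifier, unary_encodeGraph, afterGraph_encodeGraph, hu, this]

end SymBreak

theorem mainTheorem3 (t : ℕ) (ht : 2 ≤ t)
    (h : SymBreak.JohnsonSymmetryBreakingInPolyTime t) :
    (∃ f : ∀ n : ℕ, SimpleGraph (Fin n) → SimpleGraph (Fin n),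
      SymBreak.IsCanonicalForm f ∧ SymBreak.dGCanon f ∈ SymBreak.NP) ∧
    SymBreak.GI ∈ SymBreak.coNP := by
  obtain ⟨f, hf, hNP⟩ := SymBreak.exists_canonicalForm ht h
  exact ⟨⟨f, hf, hNP⟩, SymBreak.GI_mem_coNP hf hNP⟩
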